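/- **Setting.** Let $q\ge 2$, $n\ge 1$. A variational circuit $U(\theta)$, $\theta\in[0,2\pi]^p$, acts on $n$ qudits of dimension $q$ started in $|0^n\rangle$. It contains $m$ entangling gates $V_1,\dots,V_m$ in time order, each acting on an arbitrary pair of distinct sites, such that every qudit is acted on by at least one of them. The $V_t$ are independent, each drawn from a probability measure on $\mathrm U(q^2)$ that is a unitary 2-design. Each entangling gate is immediately preceded and succeeded by arbitrarily many parameterized gates $W_l e^{-iA\theta_k}W_r$ on one or both of its sites ($A$ Hermitian, $\theta\mapsto e^{-iA\theta}$ of period $2\pi$, $W_l,W_r$ fixed unitaries); there are no other gates. Let $M_0=I,M_1,\dots,M_{q^2-1}\in\mathbb C^{q\times q}$ satisfy $\mathrm{tr}(M_i^\dagger M_j)=q\,\delta_{ij}$, and for $\mathbf x\in\{0,\dots,q^2-1\}^n$ put $M_{\mathbf x}=M_{\mathbf x_1}\otimes\cdots\otimes M_{\mathbf x_n}$ and $\mathrm{supp}(\mathbf x)=\{k:\mathbf x_k\ne0\}$. Let $H=\sum_{\mathbf x}c_{\mathbf x}M_{\mathbf x}$ be a nonzero Hermitian operator, $S=\sum_{\mathbf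 x}|c_{\mathbf x}|^2$, and $f_V(\theta)=\langle 0^n|U(\theta)^\dagger H\,U(\theta)|0^n\rangle$. Let $\mathbb E_V$ be the expectation over the entangling gates and $\mathbb E_\theta$ the average over uniform $\theta\in[0,2\pi]^p$. The *biased random walk* on $\{\mathtt I,\mathtt S\}^n$ starts with each site independently labelled $\mathtt S$ with probability $1/(q+1)$ and $\mathtt I$ otherwise. Then the entangling gates act in order: a gate leaves two equal labels unchanged, and turns two different labels into $(\mathtt S,\mathtt S)$ with probability $1/(q^2+1)$ and into $(\mathtt I,\mathtt I)$ otherwise. Let $\Gamma^m$ be the final configuration and $\mathrm{supp}(\Gamma^m)$ the set of sites labelled $\mathtt S$. **Algorithm.** Given the circuit, the number $S$, an oracle that returns independent samples $\mathbf X$ with $\Pr[\mathbf X=\mathbf x]=|c_{\mathbf x}|^2/S$, and $\varepsilon>0$, $0<\delta<1$, put $N=\left\lceil\tfrac12\log(2/\delta)\,(S/\varepsilon)^2\right\rceil$. For $i=1,\dots,N$, simulate the walk to sample $\Gamma^m$, draw $\mathbf X$, and set $a_i=1$ if $\mathrm{supp}(\mathbf X)\subseteq\mathrm{supp}(\Gamma^m)$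 and $a_i=0$ otherwise. Return $S\,N^{-1}\sum_{i=1}^N a_i$. The algorithm is implemented by an explicit program for a randomized random-access machine with integer and real registers. Each elementary operation (reading or writing a register or array cell, comparison, real arithmetic, logarithm, rounding up, a biased coin flip, incrementing a loop counter) costs one unit, and an oracle draw of $\mathbf X$ costs $n+1$ units. **Theorem.** There is an absolute constant $C>0$ such that for all such data: 1. The output of the program is distributed as $S\,N^{-1}\sum_{i=1}^N a_i$ with $a_1,\dots,a_N$ independent copies of the indicator of $\mathrm{supp}(\mathbf X)\subseteq\mathrm{supp}(\Gamma^m)$, where $\mathbf X$ and $\Gamma^m$ are independent. 2. With probability at least $1-\delta$ the output differs from $\mathbb E_V\mathbb E_\theta f_V(\theta)^2$ by at most $\varepsilon$. 3. The running time is, with certainty, at most $C\,m\,N$; in particular, if $\varepsilon\le S$ and $\delta\le\frac12$, it is at most $C\,m\,S^2\log(1/\delta)\,\varepsilon^{-2}$. -/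

import Mathlib

open MeasureTheory
open scoped ENNReal

namespace BarrenPlateau

noncomputable section

/-! ### Random unitaries and 2-designs -/

section Unitary

variable {ι : Type} [Fintype ι] [DecidableEq ι]

instance : MeasurableSpace (Matrix.unitaryGroup ι ℂ) := borel _

instance : BorelSpace (Matrix.unitaryGroup ι ℂ) := ⟨rfl⟩

instance : CompactSpace (Matrix.unitaryGroup ι ℂ) := by
  have hK : IsCompact (Set.univ.pi fun _ : ι => Set.univ.pi fun _ : ι =>
      Metric.closedBall (0 : ℂ) 1) :=
    isCompact_univ_pi fun _ => isCompact_univ_pi fun _ => isCompact_closedBall _ _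
  have hc : IsClosed ((Matrix.unitaryGroup ι ℂ : Set (Matrix ι ι ℂ))) := isClosed_unitary
  refine isCompact_iff_compactSpace.mp (hK.of_isClosed_subset hc ?_)
  intro U hU i _ j _
  simpa using entry_norm_bound_of_unitary hU i j

/-- The Haar probability measure on the unitary group. -/
def haarUnitary (ι : Type) [Fintype ι] [DecidableEq ι] : Measure (Matrix.unitaryGroup ι ℂ) :=
  Measure.haarMeasure ⊤

/-- `μ` is a unitary 2-design: a probability measure whose moment operator
`𝔼 [U ⊗ U ⊗ Ū ⊗ Ū]` coincides, entry by entry, with that of the Haar measure. -/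
def IsTwoDesign (μ : Measure (Matrix.unitaryGroup ι ℂ)) : Prop :=
  IsProbabilityMeasure μ ∧
    ∀ a₁ a₂ a₃ a₄ b₁ b₂ b₃ b₄ : ι,
      ∫ U, (U : Matrix ι ι ℂ) a₁ b₁ * (U : Matrix ι ι ℂ) a₂ b₂ *
          star ((U : Matrix ι ι ℂ) a₃ b₃) * star ((U : Matrix ι ι ℂ) a₄ b₄) ∂μ =
        ∫ U, (U : Matrix ι ι ℂ) a₁ b₁ * (U : Matrix ι ι ℂ) a₂ b₂ *
          star ((U : Matrix ι ι ℂ) a₃ b₃) * star ((U : Matrix ι ι ℂ) a₄ b₄) ∂(haarUnitary ι)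

end Unitary

/-! ### Variational circuits

The computational basis of `n` qudits of dimension `q` is indexed by `Fin n → Fin q`, and
`Fin q × Fin q` indexes the basis of a pair of qudits. -/

/-- Operators on the space of two qudits. -/
abbrev TwoSiteOp (q : ℕ) := Matrix (Fin q × Fin q) (Fin q × Fin q) ℂ

/-- Operators on the space of `n` qudits. -/
abbrev QuditOp (n q : ℕ) := Matrix (Fin n → Fin q) (Fin n → Fin q) ℂ

/-- The operator on `n` qudits acting as `G` on the ordered pair of sites `(i, j)` (with `i ≠ j`)
and as the identity on the other sites. -/
def embed {n q : ℕ} (i j : Fin n) (G : TwoSiteOp q) : QuditOp n q :=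
  fun x y => if ∀ k, k ≠ i → k ≠ j → x k = y k then G (x i, x j) (y i, y j) else 0

/-- A parameterized gate `W_l e^{-iAθ} W_r` on a pair of sites, with `θ ↦ e^{-iAθ}` of period
`2π`. A gate acting on only one of the two sites is one with `A = a ⊗ 1` or `A = 1 ⊗ a`, and
likewise for `W_l` and `W_r`. The field `param` says which of the `p` parameters `θ` is. -/
structure ParamGate (q p : ℕ) where
  gen : TwoSiteOp q
  isHermitian : gen.IsHermitian
  periodic : ∀ θ : ℝ, NormedSpace.exp ((-Complex.I * ((θ + 2 * Real.pi : ℝ) : ℂ)) • gen) =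
    NormedSpace.exp ((-Complex.I * (θ : ℂ)) • gen)
  left : Matrix.unitaryGroup (Fin q × Fin q) ℂ
  right : Matrix.unitaryGroup (Fin q × Fin q) ℂ
  param : Fin p

/-- The matrix of a parameterized gate. -/
def ParamGate.mat {q p : ℕ} (g : ParamGate q p) (θ : Fin p → ℝ) : TwoSiteOp q :=
  (g.left : TwoSiteOp q) * NormedSpace.exp ((-Complex.I * (θ g.param : ℂ)) • g.gen) *
    (g.right : TwoSiteOp q)

/-- The product of a list of parameterized gates on one pair of sites, earliest gate first. -/
def seqMat {q p : ℕ} (l : List (ParamGate q p)) (θ : Fin p → ℝ) : TwoSiteOp q :=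
  l.foldl (fun acc g => g.mat θ * acc) 1

/-- An entangling gate on the sites `fst ≠ snd`, with the parameterized gates on one or both of
these two sites that immediately precede it (`pre`) and succeed it (`post`), in time order. -/
structure Block (n q p : ℕ) where
  fst : Fin n
  snd : Fin n
  ne : fst ≠ snd
  pre : List (ParamGate q p)
  post : List (ParamGate q p)

/-- A variational circuit on `n` qudits of dimension `q` with `m` entangling gates and `p`
parameters: entangling gates in time order, on arbitrary pairs of sites, each preceded and
succeeded by parameterized gates on its sites, such that each qudit is acted on by an entangling
gate at least once. -/
structure Circuit (n q m p : ℕ) where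
  block : Fin m → Block n q p
  covers : ∀ k : Fin n, ∃ t, k = (block t).fst ∨ k = (block t).snd

variable {n q m p : ℕ}

/-- A realization of the `m` entangling gates. -/
abbrev Realization (q m : ℕ) := Fin m → Matrix.unitaryGroup (Fin q × Fin q) ℂ

/-- The operator of the `t`-th block of the circuit. -/
def Circuit.blockMat (U : Circuit n q m p) (V : Realization q m) (θ : Fin p → ℝ) (t : Fin m) :
    QuditOp n q :=
  embed (U.block t).fst (U.block t).snd
    (seqMat (U.block t).post θ * (V t : TwoSiteOp q) * seqMat (U.block t).pre θ)

/-- The operator `U(θ)` of the whole circuit; the block `0` acts first. -/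
def Circuit.mat (U : Circuit n q m p) (V : Realization q m) (θ : Fin p → ℝ) : QuditOp n q :=
  (List.finRange m).foldl (fun acc t => U.blockMat V θ t * acc) 1

/-- The objective function `f_V(θ) = ⟨0ⁿ| U(θ)† H U(θ) |0ⁿ⟩`. -/
def Circuit.objective [NeZero q] (U : Circuit n q m p) (H : QuditOp n q) (V : Realization q m)
    (θ : Fin p → ℝ) : ℝ :=
  (((U.mat V θ).conjTranspose * H * U.mat V θ) (fun _ => 0) (fun _ => 0)).re

/-- `𝔼_V 𝔼_θ f_V(θ)²`: the entangling gates are independent, the `t`-th one with law `μ t`, and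
`θ` is uniform on `[0, 2π]^p`. -/
def Circuit.secondMoment [NeZero q] (U : Circuit n q m p)
    (μ : Fin m → Measure (Matrix.unitaryGroup (Fin q × Fin q) ℂ)) (H : QuditOp n q) : ℝ :=
  ∫ V, (⨍ θ in Set.Icc (0 : Fin p → ℝ) (fun _ => 2 * Real.pi), U.objective H V θ ^ 2)
    ∂(Measure.pi μ)

/-! ### The observable -/

/-- Matrices `M_0 = 1, M_1, …, M_{q²-1}` with `tr (M_i† M_j) = q δ_{ij}`. -/
structure OperatorBasis (q : ℕ) [NeZero q] where
  op : Fin (q ^ 2) → Matrix (Fin q) (Fin q) ℂ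
  op_zero : op 0 = 1
  trace_mul : ∀ i j, ((op i).conjTranspose * op j).trace = if i = j then (q : ℂ) else 0

/-- `M_x = M_{x_1} ⊗ ⋯ ⊗ M_{x_n}`. -/
def OperatorBasis.string [NeZero q] (M : OperatorBasis q) (x : Fin n → Fin (q ^ 2)) :
    QuditOp n q :=
  fun a b => ∏ k, M.op (x k) (a k) (b k)

/-- `H = ∑_x c_x M_x`. -/
def OperatorBasis.observable [NeZero q] (M : OperatorBasis q)
    (c : (Fin n → Fin (q ^ 2)) → ℂ) : QuditOp n q :=
  ∑ x, c x • M.string x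

/-- `∑_x |c_x|²`. -/
def weight (c : (Fin n → Fin (q ^ 2)) → ℂ) : ℝ := ∑ x, ‖c x‖ ^ 2

lemma weight_pos {c : (Fin n → Fin (q ^ 2)) → ℂ} (hc : c ≠ 0) : 0 < weight c := by
  obtain ⟨x, hx⟩ := Function.ne_iff.mp hc
  exact Finset.sum_pos' (fun _ _ => by positivity)
    ⟨x, Finset.mem_univ _, by have : 0 < ‖c x‖ := norm_pos_iff.mpr hx
                              positivity⟩

/-- The law of `X`: `Pr[X = x] = |c_x|² / ∑_y |c_y|²`. -/
def coeffPMF (c : (Fin n → Fin (q ^ 2)) → ℂ) (hc : c ≠ 0) : PMF (Fin n → Fin (q ^ 2)) :=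
  PMF.ofFintype (fun x => ENNReal.ofReal (‖c x‖ ^ 2 / weight c)) (by
    have h := weight_pos hc
    rw [← ENNReal.ofReal_sum_of_nonneg (fun x _ => by positivity), ← Finset.sum_div]
    change ENNReal.ofReal (weight c / weight c) = 1
    rw [div_self h.ne', ENNReal.ofReal_one])

/-! ### The biased random walk -/

/-- A coin with `Pr[true] = r`; values of `r` outside `[0, 1]` are clamped. -/
def coin (r : ℝ) : PMF Bool :=
  PMF.ofFintype (fun b => ENNReal.ofReal (if b then max 0 (min r 1) else 1 - max 0 (min r 1))) (by
    have h0 : (0 : ℝ) ≤ max 0 (min r 1) := le_max_left _ _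
    have h1 : max 0 (min r 1) ≤ (1 : ℝ) := max_le zero_le_one (min_le_right _ _)
    rw [Fintype.sum_bool, ← ENNReal.ofReal_add (by simp) (by simp)]
    simp)

/-- A configuration of labels: `true` is the label `S` and `false` is the label `I`. -/
abbrev Config (n : ℕ) := Fin n → Bool

/-- Each site is independently labelled `S` with probability `1/(q+1)`. -/
def initConfig (n q : ℕ) : PMF (Config n) :=
  PMF.ofFintype (fun γ => ∏ k, coin (1 / ((q : ℝ) + 1)) (γ k)) (by
    rw [← Fintype.prod_sum]
    have h : ∑ b, coin (1 / ((q : ℝ) + 1)) b = 1 := by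
      have h' := PMF.tsum_coe (coin (1 / ((q : ℝ) + 1)))
      rwa [tsum_fintype] at h'
    simp only [h, Finset.prod_const_one])

/-- A gate on the sites `i, j` leaves equal labels unchanged, and otherwise makes both of them
`S` with probability `1/(q²+1)` and both of them `I` else. -/
def gateStep (q : ℕ) (i j : Fin n) (γ : Config n) : PMF (Config n) :=
  if γ i = γ j then PMF.pure γ
  else (coin (1 / ((q : ℝ) ^ 2 + 1))).map fun b => Function.update (Function.update γ i b) j b

/-- The law of the final configuration `Γ^m` of the biased random walk of the circuit. -/
def Circuit.finalConfig (U : Circuit n q m p) : PMF (Config n) :=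
  (List.finRange m).foldl
    (fun P t => P.bind (gateStep q (U.block t).fst (U.block t).snd)) (initConfig n q)

/-- The law of one sample `a_i = 𝟙[supp X ⊆ supp Γ^m]`, with `Γ^m` and `X` independent. -/
def Circuit.sample [NeZero q] (U : Circuit n q m p) (c : (Fin n → Fin (q ^ 2)) → ℂ) (hc : c ≠ 0) :
    PMF ℕ :=
  U.finalConfig.bind fun γ => (coeffPMF c hc).map fun x =>
    if ∀ k, x k ≠ 0 → γ k = true then 1 else 0

/-- The law of the sum of `N` independent random variables of law `P`. -/
def sumIID (P : PMF ℕ) : ℕ → PMF ℕ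
  | 0 => PMF.pure 0
  | N + 1 => (sumIID P N).bind fun s => P.map fun a => s + a

/-- The law of `(∑_x |c_x|²) N⁻¹ ∑_{i=1}^N a_i`, with independent samples `a_i`. -/
def Circuit.estimator [NeZero q] (U : Circuit n q m p) (c : (Fin n → Fin (q ^ 2)) → ℂ)
    (hc : c ≠ 0) (N : ℕ) : PMF ℝ :=
  (sumIID (U.sample c hc) N).map fun s => weight c * (N : ℝ)⁻¹ * (s : ℝ)

/-- The number of samples, `½ log (2/δ) (S/ε)²` rounded up, where `S = ∑_x |c_x|²`. -/
def numSamples (S ε δ : ℝ) : ℕ := ⌈(1 / 2) * Real.log (2 / δ) * (S / ε) ^ 2⌉₊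

/-! ### A randomized random-access machine with unit-cost operations

Programs manipulate integer registers, real registers and integer arrays. Every node of an
expression and every command costs one unit of time, except that the command `draw`, which calls
the oracle returning a random string of length `L`, costs `L + 1`. -/

/-- Integer registers. -/
inductive NReg
  | n | m | q | N | i | s | t | u | v | b | hit | count
  deriving DecidableEq

/-- Real registers. -/
inductive RReg
  | S | eps | delta | p0 | p1 | out
  deriving DecidableEq

/-- Arrays of integers. -/
inductive Arr
  | gateFst | gateSnd | label | X
  deriving DecidableEq

/-- The memory of the machine. -/
structure Store where
  nat : NReg → ℕ
  real : RReg → ℝ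
  arr : Arr → ℕ → ℕ

/-- Integer expressions: constants, registers, array cells and sums. -/
inductive NExpr
  | const (k : ℕ)
  | reg (r : NReg)
  | cell (a : Arr) (e : NExpr)
  | add (e₁ e₂ : NExpr)

/-- The value of an integer expression. -/
def NExpr.eval (σ : Store) : NExpr → ℕ
  | const k => k
  | reg r => σ.nat r
  | cell a e => σ.arr a (e.eval σ)
  | add e₁ e₂ => e₁.eval σ + e₂.eval σ

/-- The time needed to evaluate an integer expression. -/
def NExpr.cost : NExpr → ℕ
  | const _ => 1
  | reg _ => 1
  | cell _ e => e.cost + 1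
  | add e₁ e₂ => e₁.cost + e₂.cost + 1

/-- Real expressions. -/
inductive RExpr
  | ofNat (e : NExpr)
  | reg (r : RReg)
  | add (e₁ e₂ : RExpr)
  | mul (e₁ e₂ : RExpr)
  | div (e₁ e₂ : RExpr)
  | log (e : RExpr)

/-- The value of a real expression. -/
def RExpr.eval (σ : Store) : RExpr → ℝ
  | ofNat e => (e.eval σ : ℝ)
  | reg r => σ.real r
  | add e₁ e₂ => e₁.eval σ + e₂.eval σ
  | mul e₁ e₂ => e₁.eval σ * e₂.eval σ
  | div e₁ e₂ => e₁.eval σ / e₂.eval σ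
  | log e => Real.log (e.eval σ)

/-- The time needed to evaluate a real expression. -/
def RExpr.cost : RExpr → ℕ
  | ofNat e => e.cost + 1
  | reg _ => 1
  | add e₁ e₂ => e₁.cost + e₂.cost + 1
  | mul e₁ e₂ => e₁.cost + e₂.cost + 1
  | div e₁ e₂ => e₁.cost + e₂.cost + 1
  | log e => e.cost + 1

/-- Commands. `setN`, `setR`, `setCell` are assignments, `ceil r e` puts `⌈e⌉` into `r`,
`flip r e` sets `r` to `1` with probability `e` and to `0` otherwise, `draw a` writes a fresh
string from the oracle into the array `a`, `ifEq e₁ e₂ c₁ c₂` runs `c₁` if `e₁ = e₂` and `c₂`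
otherwise, and `loop r e c` runs `c` for `r = 0, 1, …, e - 1`. -/
inductive Cmd
  | skip
  | setN (r : NReg) (e : NExpr)
  | setR (r : RReg) (e : RExpr)
  | setCell (a : Arr) (e₁ e₂ : NExpr)
  | ceil (r : NReg) (e : RExpr)
  | flip (r : NReg) (e : RExpr)
  | draw (a : Arr)
  | seq (c₁ c₂ : Cmd)
  | ifEq (e₁ e₂ : NExpr) (c₁ c₂ : Cmd)
  | loop (r : NReg) (e : NExpr) (c : Cmd)

namespace Store

def setN (σ : Store) (r : NReg) (k : ℕ) : Store := { σ with nat := Function.update σ.nat r k }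

def setR (σ : Store) (r : RReg) (x : ℝ) : Store := { σ with real := Function.update σ.real r x }

def setArr (σ : Store) (a : Arr) (f : ℕ → ℕ) : Store :=
  { σ with arr := Function.update σ.arr a f }

end Store

/-- Runs `body` for `r = 0, …, K - 1`, with one unit of time per iteration for the counter. -/
def runLoop (body : Store → PMF (Store × ℕ)) (r : NReg) (σ : Store) : ℕ → PMF (Store × ℕ)
  | 0 => PMF.pure (σ, 0)
  | K + 1 => (runLoop body r σ K).bind fun o =>
      (body (o.1.setN r K)).map fun o' => (o'.1, o.2 + o'.2 + 1)

/-- The joint law of the final memory and of the running time of a command started in memory `σ`,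
when the oracle draws independent strings of law `D`. -/
def Cmd.run {L : ℕ} (D : PMF (Fin L → ℕ)) : Cmd → Store → PMF (Store × ℕ)
  | skip, σ => PMF.pure (σ, 1)
  | setN r e, σ => PMF.pure (σ.setN r (e.eval σ), e.cost + 1)
  | setR r e, σ => PMF.pure (σ.setR r (e.eval σ), e.cost + 1)
  | setCell a e₁ e₂, σ =>
      PMF.pure (σ.setArr a (Function.update (σ.arr a) (e₁.eval σ) (e₂.eval σ)),
        e₁.cost + e₂.cost + 1)
  | ceil r e, σ => PMF.pure (σ.setN r ⌈e.eval σ⌉₊, e.cost + 1)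
  | flip r e, σ => (coin (e.eval σ)).map fun b => (σ.setN r (if b then 1 else 0), e.cost + 1)
  | draw a, σ => D.map fun x =>
      (σ.setArr a (fun k => if h : k < L then x ⟨k, h⟩ else σ.arr a k), L + 1)
  | seq c₁ c₂, σ => (c₁.run D σ).bind fun o =>
      (c₂.run D o.1).map fun o' => (o'.1, o.2 + o'.2 + 1)
  | ifEq e₁ e₂ c₁ c₂, σ =>
      (if e₁.eval σ = e₂.eval σ then c₁.run D σ else c₂.run D σ).map fun o =>
        (o.1, o.2 + e₁.cost + e₂.cost + 1)
  | loop r e c, σ => (runLoop (c.run D) r σ (e.eval σ)).map fun o => (o.1, o.2 + e.cost + 1)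

/-! ### The Monte Carlo algorithm as a program -/

/-- Runs a list of commands in order. -/
def Cmd.block : List Cmd → Cmd
  | [] => .skip
  | c :: l => .seq c (Cmd.block l)

/-- `N ← ⌈½ log (2/δ) (S/ε)²⌉` together with the flip probabilities of the walk,
`p0 = 1/(q+1)` and `p1 = 1/(q²+1)`. -/
def setup : Cmd :=
  .block [
    .ceil .N (.mul (.mul (.div (.ofNat (.const 1)) (.ofNat (.const 2)))
      (.log (.div (.ofNat (.const 2)) (.reg .delta))))
      (.mul (.div (.reg .S) (.reg .eps)) (.div (.reg .S) (.reg .eps)))),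
    .setR .p0 (.div (.ofNat (.const 1)) (.add (.ofNat (.reg .q)) (.ofNat (.const 1)))),
    .setR .p1 (.div (.ofNat (.const 1))
      (.add (.mul (.ofNat (.reg .q)) (.ofNat (.reg .q))) (.ofNat (.const 1)))),
    .setN .count (.const 0)]

/-- Simulates the biased walk; the array `label` ends up holding `Γ^m` (`1` for `S`, `0` for
`I`). -/
def simulateWalk : Cmd :=
  .block [
    .loop .s (.reg .n) (.block [
      .flip .b (.reg .p0),
      .setCell .label (.reg .s) (.reg .b)]),
    .loop .t (.reg .m) (.block [
      .setN .u (.cell .gateFst (.reg .t)),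
      .setN .v (.cell .gateSnd (.reg .t)),
      .ifEq (.cell .label (.reg .u)) (.cell .label (.reg .v)) .skip (.block [
        .flip .b (.reg .p1),
        .setCell .label (.reg .u) (.reg .b),
        .setCell .label (.reg .v) (.reg .b)])])]

/-- `hit ← 𝟙[supp X ⊆ supp Γ^m]`. -/
def testSupport : Cmd :=
  .block [
    .setN .hit (.const 1),
    .loop .s (.reg .n)
      (.ifEq (.cell .X (.reg .s)) (.const 0) .skip
        (.ifEq (.cell .label (.reg .s)) (.const 1) .skip (.setN .hit (.const 0))))]

/-- The whole algorithm; the result is left in the register `out`. -/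
def monteCarlo : Cmd :=
  .block [
    setup,
    .loop .i (.reg .N) (.block [
      simulateWalk,
      .draw .X,
      testSupport,
      .setN .count (.add (.reg .count) (.reg .hit))]),
    .setR .out (.mul (.mul (.reg .S) (.div (.ofNat (.const 1)) (.ofNat (.reg .N))))
      (.ofNat (.reg .count)))]

/-- The memory holding the input: `n`, `m`, `q`, the list of the sites of the entangling gates,
`S = ∑_x |c_x|²`, `ε` and `δ`. -/
def Circuit.input (U : Circuit n q m p) (S ε δ : ℝ) : Store where
  nat
    | .n => n
    | .m => m
    | .q => q
    | _ => 0
  real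
    | .S => S
    | .eps => ε
    | .delta => δ
    | _ => 0
  arr
    | .gateFst => fun t => if h : t < m then ((U.block ⟨t, h⟩).fst : ℕ) else 0
    | .gateSnd => fun t => if h : t < m then ((U.block ⟨t, h⟩).snd : ℕ) else 0
    | _ => fun _ => 0

/-- The joint law of final memory and running time of the algorithm on the circuit `U` and the
observable `H = ∑_x c_x M_x`, to which it has access through the number `∑_x |c_x|²` and an oracle
drawing `X` with probability proportional to `|c_x|²`. -/
def Circuit.runMonteCarlo (U : Circuit n q m p) (c : (Fin n → Fin (q ^ 2)) → ℂ)
    (hc : c ≠ 0) (ε δ : ℝ) : PMF (Store × ℕ) :=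
  monteCarlo.run ((coeffPMF c hc).map fun x k => (x k : ℕ)) (U.input (weight c) ε δ)

end

end BarrenPlateau

open BarrenPlateau

/-! The square of an expectation value is linear in ψ⊗ψ⊗ψ̄⊗ψ̄, so averaging over a gate V only
involves the mean of V⊗V⊗V̄⊗V̄. A tensor fixed by every U⊗U⊗Ū⊗Ū is a combination of two pairings,
the identity I and the swap S (`exists_eq_pairing_of_invariant`). The mean over a 2-design is
therefore a Weingarten sum over pairs of labels. The pairings are themselves fixed by unitaries, so
parameterized gates around V do not change this mean (`integral_momentMat_mul_mul`), and the average
over V does not depend on θ.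

The pairing of a two-site system is the product of the pairings of its sites. Averaging a gate thus
turns a product of single-site functionals into a combination of such products. In terms of
normalized pairings the coefficients are exactly the transition probabilities of the biased walk
(`expect_gateStep`), and the initial bias 1/(q+1) reproduces the value of either pairing on |0⟩
(`isInitial_pairing`). Peeling gates off from the last one, `integral_expval_finalState` identifies
the averaged functional with an expectation over the final configuration. For the functional built
from M_x and the conjugate of M_y, trace orthogonality leaves 1 when x = y is supported on the S
sites and 0 otherwise. Hence the second moment is S·Pr[supp X ⊆ supp Γ^m] (`weight_mul_hit`), and
Hoeffding's inequality controls the empirical mean.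

The program is analysed by coupling: `Sim` relates a run to the ideal random process and carries the
time bound inside the relation. The single derivation `sim_monteCarlo` then yields both the law of
the output and a bound on the time of every possible run. Since each gate touches two sites and all
sites are touched, n ≤ 2m, so a round costs O(m). -/

namespace BarrenPlateau

noncomputable section

open scoped Kronecker Matrix

/-! ### Second moments of unitary 2-designs. -/

section Weingarten

variable {ι : Type}

/-- Indices of a fourfold tensor: two ket indices followed by two bra indices. -/
abbrev Quad (ι : Type) := ι × ι × ι × ι

/-- The moment matrix `U ⊗ U ⊗ Ū ⊗ Ū`. -/
def momentMat (U : Matrix ι ι ℂ) : Matrix (Quad ι) (Quad ι) ℂ :=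
  U ⊗ₖ (U ⊗ₖ (U.map star ⊗ₖ U.map star))

lemma momentMat_apply (U : Matrix ι ι ℂ) (a b : Quad ι) :
    momentMat U a b = U a.1 b.1 * (U a.2.1 b.2.1 *
      (star (U a.2.2.1 b.2.2.1) * star (U a.2.2.2 b.2.2.2))) := rfl

variable [Fintype ι]

lemma momentMat_mul (U V : Matrix ι ι ℂ) : momentMat (U * V) = momentMat U * momentMat V := by
  have h : (U * V).map star = U.map star * V.map star := by
    ext i j
    simp [Matrix.mul_apply]
  simp only [momentMat, h, Matrix.mul_kronecker_mul]

variable [DecidableEq ι]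

/-- The pairing tensors: `δ₁₃ δ₂₄` for the label `I` and `δ₁₄ δ₂₃` for the label `S`. -/
def pairing (l : Bool) (a : Quad ι) : ℂ :=
  if l then (if a.1 = a.2.2.2 then 1 else 0) * (if a.2.1 = a.2.2.1 then 1 else 0)
  else (if a.1 = a.2.2.1 then 1 else 0) * (if a.2.1 = a.2.2.2 then 1 else 0)

lemma sum_row_mul_star {U : Matrix ι ι ℂ} (hU : U ∈ Matrix.unitaryGroup ι ℂ) (a b : ι) :
    ∑ c, U a c * star (U b c) = if a = b then 1 else 0 := by
  have h := congrFun (congrFun (Matrix.mem_unitaryGroup_iff.mp hU) a) b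
  simpa [Matrix.mul_apply, Matrix.one_apply] using h

/-- Either pairing contracts each U factor with a Ū factor, so the sum splits into two inner
products of rows of U. -/
lemma momentMat_mulVec_pairing {U : Matrix ι ι ℂ} (hU : U ∈ Matrix.unitaryGroup ι ℂ) (l : Bool) :
    momentMat U *ᵥ pairing l = pairing l := by
  ext ⟨a₁, a₂, a₃, a₄⟩
  cases l
  · calc _ = (∑ c, U a₁ c * star (U a₃ c)) * ∑ c, U a₂ c * star (U a₄ c) := by
          simp only [Matrix.mulVec, dotProduct, momentMat_apply, pairing, Fintype.sum_prod_type]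
          simp [Finset.sum_mul_sum, mul_comm, mul_left_comm]
      _ = _ := by simp only [sum_row_mul_star hU]; simp [pairing]
  · calc _ = (∑ c, U a₁ c * star (U a₄ c)) * ∑ c, U a₂ c * star (U a₃ c) := by
          simp only [Matrix.mulVec, dotProduct, momentMat_apply, pairing, Fintype.sum_prod_type]
          simp [Finset.sum_mul_sum, mul_comm, mul_left_comm]
      _ = _ := by simp only [sum_row_mul_star hU]; simp [pairing]

lemma transpose_mem_unitaryGroup {U : Matrix ι ι ℂ} (hU : U ∈ Matrix.unitaryGroup ι ℂ) :
    U.transpose ∈ Matrix.unitaryGroup ι ℂ := by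
  rw [Matrix.mem_unitaryGroup_iff', Matrix.star_eq_conjTranspose]
  have h := congrArg Matrix.transpose (Matrix.mem_unitaryGroup_iff.mp hU)
  rw [Matrix.transpose_mul, Matrix.transpose_one] at h
  exact h

lemma pairing_vecMul_momentMat {U : Matrix ι ι ℂ} (hU : U ∈ Matrix.unitaryGroup ι ℂ) (l : Bool) :
    pairing l ᵥ* momentMat U = pairing l := by
  rw [← Matrix.mulVec_transpose]
  -- The transpose of `momentMat U` is by definition the moment matrix of the transpose of U.
  exact momentMat_mulVec_pairing (transpose_mem_unitaryGroup hU) l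

lemma pairing_dotProduct_pairing (l l' : Bool) :
    (pairing l : Quad ι → ℂ) ⬝ᵥ pairing l' =
      if l = l' then (Fintype.card ι : ℂ) ^ 2 else (Fintype.card ι : ℂ) := by
  cases l <;> cases l' <;>
    simp [dotProduct, pairing, Fintype.sum_prod_type, sq]

/-- A tensor invariant under `U ⊗ U ⊗ Ū ⊗ Ū` for all unitary `U` is a combination of the two
pairings. -/
lemma exists_eq_pairing_of_invariant (hι : 2 ≤ Fintype.card ι) (X : Quad ι → ℂ)
    (hX : ∀ U ∈ Matrix.unitaryGroup ι ℂ, momentMat U *ᵥ X = X) :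
    ∃ α β : ℂ, X = α • pairing false + β • pairing true := by
  obtain ⟨e, f, hef⟩ := Fintype.one_lt_card_iff.mp hι
  -- phases
  have hphase : ∀ (g : ι) (a : Quad ι),
      (if a.1 = g then Complex.I else 1) * ((if a.2.1 = g then Complex.I else 1) *
        ((if a.2.2.1 = g then -Complex.I else 1) * (if a.2.2.2 = g then -Complex.I else 1))) * X a
        = X a := by
    intro g a
    have hU : Matrix.diagonal (fun i => if i = g then Complex.I else (1 : ℂ)) ∈
        Matrix.unitaryGroup ι ℂ := by
      rw [Matrix.mem_unitaryGroup_iff, Matrix.star_eq_conjTranspose,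
        Matrix.diagonal_conjTranspose, Matrix.diagonal_mul_diagonal, ← Matrix.diagonal_one]
      congr 1
      ext i
      by_cases h : i = g <;> simp [h]
    have h := congrFun (hX _ hU) a
    obtain ⟨a₁, a₂, a₃, a₄⟩ := a
    simp only [Matrix.mulVec, dotProduct, momentMat_apply, Fintype.sum_prod_type,
      Matrix.diagonal_apply, apply_ite star, star_zero, star_one, Complex.star_def,
      Complex.conj_I] at h
    simpa [Finset.sum_ite_eq, mul_assoc] using h
  have hperm : ∀ (π : Equiv.Perm ι) (a₁ a₂ a₃ a₄ : ι),
      X (π a₁, π a₂, π a₃, π a₄) = X (a₁, a₂, a₃, a₄) := by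
    intro π a₁ a₂ a₃ a₄
    have hU : (Matrix.of fun i j => if π i = j then (1 : ℂ) else 0) ∈
        Matrix.unitaryGroup ι ℂ := by
      rw [Matrix.mem_unitaryGroup_iff]
      ext i j
      simp [Matrix.mul_apply, Matrix.one_apply, apply_ite star]
    have h := congrFun (hX _ hU) (a₁, a₂, a₃, a₄)
    simpa [Matrix.mulVec, dotProduct, momentMat_apply, Fintype.sum_prod_type,
      apply_ite star] using h
  have heq : ∀ a : ι, X (a, a, a, a) = X (e, e, e, e) := fun a => by
    have := hperm (Equiv.swap e a) e e e e
    simpa using this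
  have hpi : ∀ a b : ι, a ≠ b → ∃ π : Equiv.Perm ι, π e = a ∧ π f = b := fun a b hab => by
    refine ⟨Equiv.swap (Equiv.swap e a f) b * Equiv.swap e a, ?_, by simp⟩
    rw [Equiv.Perm.mul_apply, Equiv.swap_apply_left, Equiv.swap_apply_of_ne_of_ne _ hab]
    intro h
    exact hef ((Equiv.swap e a).injective (by simpa using h))
  have hI : ∀ a b : ι, a ≠ b → X (a, b, a, b) = X (e, f, e, f) := fun a b hab => by
    obtain ⟨π, rfl, rfl⟩ := hpi a b hab
    exact hperm π e f e f
  have hS : ∀ a b : ι, a ≠ b → X (a, b, b, a) = X (e, f, f, e) := fun a b hab => by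
    obtain ⟨π, rfl, rfl⟩ := hpi a b hab
    exact hperm π e f f e
  have hcancel : ∀ {z x : ℂ}, z * x = x → z ≠ 1 → x = 0 := fun {z x} h hz => by
    by_contra hx
    exact hz (mul_right_cancel₀ hx (h.trans (one_mul x).symm))
  -- If kets and bras do not match as multisets, some index occurs unequally often among them. Its
  -- phase is i, -i or -1, never 1, so the entry vanishes.
  have hzero : ∀ a₁ a₂ a₃ a₄ : ι, ¬ (a₁ = a₃ ∧ a₂ = a₄) → ¬ (a₁ = a₄ ∧ a₂ = a₃) →
      X (a₁, a₂, a₃, a₄) = 0 := by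
    intro a₁ a₂ a₃ a₄ h1 h2
    have hI1 : Complex.I ≠ 1 := fun h => by simpa using congrArg Complex.re h
    have hI2 : -Complex.I ≠ 1 := fun h => by simpa using congrArg Complex.re h
    have hn : (-1 : ℂ) ≠ 1 := by norm_num
    have p1 := hphase a₁ (a₁, a₂, a₃, a₄)
    have p2 := hphase a₂ (a₁, a₂, a₃, a₄)
    have p3 := hphase a₃ (a₁, a₂, a₃, a₄)
    by_cases h13 : a₁ = a₃
    · subst h13
      have h24 : a₂ ≠ a₄ := fun h => h1 ⟨rfl, h⟩
      by_cases h12 : a₂ = a₁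
      · subst h12
        refine hcancel p1 ?_
        simpa [h24.symm] using hI1
      · refine hcancel p2 ?_
        simpa [Ne.symm h12, h24.symm] using hI1
    · by_cases h14 : a₁ = a₄
      · subst h14
        have h23 : a₂ ≠ a₃ := fun h => h2 ⟨rfl, h⟩
        refine hcancel p3 ?_
        simpa [h13, h23] using hI2
      · refine hcancel p1 ?_
        by_cases h12 : a₂ = a₁
        · simpa [h12, Ne.symm h13, Ne.symm h14] using hn
        · simpa [h12, Ne.symm h13, Ne.symm h14] using hI1
  -- Phases and permutations leave three free entries, so a unitary mixing e and f is needed. The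
  -- reflection along v = e - 2f has the rational row (3/5, 4/5). Invariance at (e,e,e,e) reads x =
  -- (337/625) x + (288/625)(y + z), where y and z are the I and S entries.
  have hrot : X (e, e, e, e) = X (e, f, e, f) + X (e, f, f, e) := by
    set v : ι → ℂ := Pi.single e 1 - (2 : ℂ) • Pi.single f 1 with hv
    have hvv : v ⬝ᵥ v = 5 := by
      simp only [hv, sub_dotProduct, dotProduct_sub, smul_dotProduct, dotProduct_smul,
        single_dotProduct, Pi.single_eq_same, Pi.single_eq_of_ne hef, Pi.single_eq_of_ne hef.symm]
      norm_num
    have hvs : star v = v := by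
      ext i
      simp [hv, Pi.single_apply, apply_ite star]
    have hU : 1 - (2 / 5 : ℂ) • Matrix.vecMulVec v v ∈ Matrix.unitaryGroup ι ℂ := by
      have hs : star (1 - (2 / 5 : ℂ) • Matrix.vecMulVec v v) =
          1 - (2 / 5 : ℂ) • Matrix.vecMulVec v v := by
        rw [Matrix.star_eq_conjTranspose, Matrix.conjTranspose_sub, Matrix.conjTranspose_smul,
          Matrix.conjTranspose_vecMulVec, hvs]
        simp
      rw [Matrix.mem_unitaryGroup_iff, hs, sub_mul, mul_sub, mul_sub, smul_mul_assoc,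
        smul_mul_assoc, mul_smul_comm, mul_smul_comm, Matrix.vecMulVec_mul_vecMulVec, hvv]
      ext i j
      simp [Matrix.vecMulVec_apply]
      ring
    have hrow : ∀ F : ι → ℂ, ∑ c, (1 - (2 / 5 : ℂ) • Matrix.vecMulVec v v) e c * F c =
        3 / 5 * F e + 4 / 5 * F f := by
      intro F
      have : ∀ c, (1 - (2 / 5 : ℂ) • Matrix.vecMulVec v v) e c =
          (if c = e then 3 / 5 else 0) + (if c = f then 4 / 5 else 0) := by
        intro c
        by_cases h1 : c = e
        · subst h1
          simp [hv, Matrix.vecMulVec_apply, hef]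
          norm_num
        · by_cases h2 : c = f
          · subst h2
            simp [hv, Matrix.vecMulVec_apply, hef, hef.symm]
            norm_num
          · simp [hv, Matrix.vecMulVec_apply, h1, h2, Ne.symm h1]
      simp [this, add_mul, Finset.sum_add_distrib]
    have hreal : ∀ c, star ((1 - (2 / 5 : ℂ) • Matrix.vecMulVec v v) e c) =
        (1 - (2 / 5 : ℂ) • Matrix.vecMulVec v v) e c := by
      intro c
      simp [hv, Matrix.vecMulVec_apply, Matrix.one_apply, Pi.single_apply, apply_ite star]
    have h := congrFun (hX _ hU) (e, e, e, e)
    simp only [Matrix.mulVec, dotProduct, momentMat_apply, Fintype.sum_prod_type, hreal,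
      mul_assoc, ← Finset.mul_sum, hrow] at h
    rw [heq f] at h
    rw [hI f e hef.symm, hS f e hef.symm, hzero e e e f, hzero e e f e, hzero e e f f,
      hzero e f e e, hzero e f f f, hzero f e e e, hzero f e f f, hzero f f e e, hzero f f e f,
      hzero f f f e] at h
    · linear_combination (-625 / 288) * h
    all_goals simp [hef, hef.symm]
  refine ⟨X (e, f, e, f), X (e, f, f, e), ?_⟩
  ext ⟨a₁, a₂, a₃, a₄⟩
  simp only [Pi.add_apply, Pi.smul_apply, smul_eq_mul, pairing]
  by_cases h1 : a₁ = a₃ ∧ a₂ = a₄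
  · obtain ⟨rfl, rfl⟩ := h1
    by_cases h12 : a₁ = a₂
    · subst h12
      simp [heq, hrot]
    · simp [h12, hI _ _ h12]
  · by_cases h2 : a₁ = a₄ ∧ a₂ = a₃
    · obtain ⟨rfl, rfl⟩ := h2
      have h12 : a₁ ≠ a₂ := fun h => h1 ⟨h, h.symm⟩
      simp [h12, hS _ _ h12]
    · rw [hzero _ _ _ _ h1 h2]
      have e1 : ((if a₁ = a₃ then 1 else 0) * (if a₂ = a₄ then 1 else 0) : ℂ) = 0 := by
        by_contra h
        apply h1
        constructor <;> by_contra h' <;> simp [h'] at h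
      have e2 : ((if a₁ = a₄ then 1 else 0) * (if a₂ = a₃ then 1 else 0) : ℂ) = 0 := by
        by_contra h
        apply h2
        constructor <;> by_contra h' <;> simp [h'] at h
      simp [e1, e2]

/-- The Weingarten coefficients for the pairings, in dimension `d`. -/
def wg (d : ℂ) (l l' : Bool) : ℂ :=
  if l = l' then d / (d * (d ^ 2 - 1)) else -1 / (d * (d ^ 2 - 1))

lemma continuous_momentMat_apply (a b : Quad ι) :
    Continuous fun U : Matrix.unitaryGroup ι ℂ => momentMat (U : Matrix ι ι ℂ) a b := by
  have h : ∀ i j : ι, Continuous fun U : Matrix.unitaryGroup ι ℂ => (U : Matrix ι ι ℂ) i j :=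
    fun i j => continuous_subtype_val.matrix_elem i j
  simp only [momentMat_apply]
  exact (h _ _).mul ((h _ _).mul ((h _ _).star.mul (h _ _).star))

lemma integrable_of_continuous {X E : Type*} [TopologicalSpace X] [CompactSpace X]
    [MeasurableSpace X] [OpensMeasurableSpace X] [NormedAddCommGroup E]
    [SecondCountableTopologyEither X E] {f : X → E} (hf : Continuous f) (μ : Measure X)
    [IsFiniteMeasure μ] : Integrable f μ :=
  hf.integrable_of_hasCompactSupport (HasCompactSupport.of_compactSpace f)

/-- Left invariance of Haar measure makes each column of the averaged moment matrix an invariant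
tensor, hence a combination of the two pairings. Contracting with the pairings, which every moment
matrix fixes, gives a 2×2 system with Gram matrix [[d², d], [d, d²]], invertible for d ≥ 2; `wg` is
its inverse. -/
lemma integral_momentMat_haar (hι : 2 ≤ Fintype.card ι) (a b : Quad ι) :
    ∫ U, momentMat (U : Matrix ι ι ℂ) a b ∂(haarUnitary ι) =
      ∑ l, ∑ l', wg (Fintype.card ι) l l' * pairing l a * pairing l' b := by
  have : IsProbabilityMeasure (haarUnitary ι) := ⟨Measure.haarMeasure_self⟩
  have hint : ∀ a b : Quad ι, Integrable (fun U : Matrix.unitaryGroup ι ℂ =>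
      momentMat (U : Matrix ι ι ℂ) a b) (haarUnitary ι) := fun a b =>
    integrable_of_continuous (continuous_momentMat_apply a b) _
  set X : Quad ι → ℂ := fun a => ∫ U, momentMat (U : Matrix ι ι ℂ) a b ∂(haarUnitary ι) with hXdef
  have hX : ∀ U ∈ Matrix.unitaryGroup ι ℂ, momentMat U *ᵥ X = X := by
    intro g hg
    ext a
    have : Measure.IsMulLeftInvariant (haarUnitary ι) := by
      unfold haarUnitary; infer_instance
    have h := integral_mul_left_eq_self (μ := haarUnitary ι)
      (fun U : Matrix.unitaryGroup ι ℂ => momentMat (U : Matrix ι ι ℂ) a b) ⟨g, hg⟩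
    rw [hXdef]
    simp only
    rw [← h]
    simp only [Matrix.mulVec, dotProduct]
    simp only [Submonoid.coe_mul, momentMat_mul, Matrix.mul_apply]
    rw [integral_finsetSum _ fun c _ => (hint c b).const_mul _]
    simp only [integral_const_mul]
  have hpair : ∀ l, pairing l ⬝ᵥ X = pairing l b := by
    intro l
    simp only [dotProduct, hXdef, ← integral_const_mul]
    rw [← integral_finsetSum _ fun c _ => (hint c b).const_mul _]
    have : ∀ U : Matrix.unitaryGroup ι ℂ,
        ∑ c, pairing l c * momentMat (U : Matrix ι ι ℂ) c b = pairing l b := fun U =>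
      congrFun (pairing_vecMul_momentMat U.2 l) b
    simp [this]
  obtain ⟨α, β, hαβ⟩ := exists_eq_pairing_of_invariant hι X hX
  have hI := hpair false
  have hS := hpair true
  rw [hαβ] at hI hS
  simp only [dotProduct_add, dotProduct_smul, pairing_dotProduct_pairing] at hI hS
  set d : ℂ := (Fintype.card ι : ℂ) with hd
  simp at hI hS
  have hd0 : d ≠ 0 := by
    rw [hd]; exact_mod_cast (by omega : Fintype.card ι ≠ 0)
  have hd1 : d ^ 2 - 1 ≠ 0 := by
    rw [hd, sub_ne_zero]
    have : 1 < Fintype.card ι ^ 2 := by nlinarith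
    exact_mod_cast this.ne'
  have hα : α = wg d false false * pairing false b + wg d false true * pairing true b := by
    simp only [wg]
    simp
    field_simp
    linear_combination hI * d - hS
  have hβ : β = wg d true false * pairing false b + wg d true true * pairing true b := by
    simp only [wg]
    simp
    field_simp
    linear_combination hS * d - hI
  change X a = _
  rw [hαβ, hα, hβ]
  simp
  ring

lemma integral_momentMat_of_isTwoDesign (hι : 2 ≤ Fintype.card ι)
    {μ : Measure (Matrix.unitaryGroup ι ℂ)} (hμ : IsTwoDesign μ) (a b : Quad ι) :
    ∫ U, momentMat (U : Matrix ι ι ℂ) a b ∂μ =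
      ∑ l, ∑ l', wg (Fintype.card ι) l l' * pairing l a * pairing l' b := by
  rw [← integral_momentMat_haar hι]
  have h := hμ.2 a.1 a.2.1 a.2.2.1 a.2.2.2 b.1 b.2.1 b.2.2.1 b.2.2.2
  simpa only [momentMat_apply, mul_assoc] using h

/-- The second moments of a 2-design are not changed by fixed unitaries before and after it. -/
lemma integral_momentMat_mul_mul (hι : 2 ≤ Fintype.card ι)
    {μ : Measure (Matrix.unitaryGroup ι ℂ)} (hμ : IsTwoDesign μ) {A B : Matrix ι ι ℂ}
    (hA : A ∈ Matrix.unitaryGroup ι ℂ) (hB : B ∈ Matrix.unitaryGroup ι ℂ) (a b : Quad ι) :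
    ∫ U, momentMat (A * (U : Matrix ι ι ℂ) * B) a b ∂μ =
      ∑ l, ∑ l', wg (Fintype.card ι) l l' * pairing l a * pairing l' b := by
  have := hμ.1
  have hint : ∀ a b : Quad ι, Integrable (fun U : Matrix.unitaryGroup ι ℂ =>
      momentMat (U : Matrix ι ι ℂ) a b) μ := fun a b =>
    integrable_of_continuous (continuous_momentMat_apply a b) _
  simp only [momentMat_mul, Matrix.mul_apply]
  rw [integral_finsetSum _ fun c _ => (integrable_finsetSum _ fun e _ =>
    (hint e c).const_mul _).mul_const _]
  have h1 : ∀ c, ∫ U : Matrix.unitaryGroup ι ℂ,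
      (∑ e, momentMat A a e * momentMat (U : Matrix ι ι ℂ) e c) * momentMat B c b ∂μ =
      (∑ e, momentMat A a e *
        ∑ l, ∑ l', wg (Fintype.card ι) l l' * pairing l e * pairing l' c) * momentMat B c b := by
    intro c
    rw [integral_mul_const, integral_finsetSum _ fun e _ => (hint e c).const_mul _]
    simp only [integral_const_mul, integral_momentMat_of_isTwoDesign hι hμ]
  simp only [h1]
  -- The fixed unitaries are absorbed because the pairings are invariant on both sides.
  have hA' : ∀ l : Bool, ∑ e, momentMat A a e * pairing l e = pairing l a := fun l =>
    congrFun (momentMat_mulVec_pairing hA l) a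
  have hB' : ∀ l : Bool, ∑ c, pairing l c * momentMat B c b = pairing l b := fun l =>
    congrFun (pairing_vecMul_momentMat hB l) b
  have h2 : ∀ c : Quad ι, ∑ e : Quad ι, momentMat A a e *
        ∑ l, ∑ l', wg (Fintype.card ι) l l' * pairing l e * pairing l' c =
      ∑ l, ∑ l', wg (Fintype.card ι) l l' * pairing l a * pairing l' c := by
    intro c
    simp only [← hA', Finset.mul_sum, Finset.sum_mul]
    rw [Finset.sum_comm]
    refine Finset.sum_congr rfl fun l _ => ?_
    rw [Finset.sum_comm]
    refine Finset.sum_congr rfl fun l' _ => Finset.sum_congr rfl fun e _ => by ring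
  simp only [h2]
  simp only [← hB', Finset.mul_sum, Finset.sum_mul]
  rw [Finset.sum_comm]
  refine Finset.sum_congr rfl fun l _ => ?_
  rw [Finset.sum_comm]
  refine Finset.sum_congr rfl fun l' _ => Finset.sum_congr rfl fun e _ => by ring

end Weingarten

/-! ### Averaging one two-site gate against a product functional. -/

section SecondMoment

variable {n q : ℕ}

lemma embed_mulVec {i j : Fin n} (hij : i ≠ j) (G : TwoSiteOp q) (ψ : (Fin n → Fin q) → ℂ)
    (x : Fin n → Fin q) :
    (embed i j G *ᵥ ψ) x = ∑ b : Fin q × Fin q, G (x i, x j) b *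
      ψ (Function.update (Function.update x i b.1) j b.2) := by
  symm
  have hi : ∀ b : Fin q × Fin q,
      Function.update (Function.update x i b.1) j b.2 i = b.1 := fun b => by
    rw [Function.update_of_ne hij, Function.update_self]
  refine Finset.sum_of_injOn
    (fun b : Fin q × Fin q => Function.update (Function.update x i b.1) j b.2) ?_ ?_ ?_ ?_
  · intro b _ b' _ h
    have h1 := congrFun h i
    have h2 := congrFun h j
    simp only [hi, Function.update_self] at h1 h2
    exact Prod.ext h1 h2
  · intro b _
    simp
  · intro y _ hy
    simp only [embed]
    rw [if_neg, zero_mul]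
    intro h
    refine hy ⟨(y i, y j), by simp, ?_⟩
    ext k
    by_cases hkj : k = j
    · subst hkj; simp
    · by_cases hki : k = i
      · subst hki; simp [hkj]
      · simp [hkj, hki, h k hki hkj]
  · intro b _
    simp only [embed]
    rw [if_pos, hi, Function.update_self]
    intro k hki hkj
    simp [hki, hkj]

/-- Groups two fourfold indices into one fourfold index of pairs. -/
def quadZip {κ κ' : Type} : Quad κ × Quad κ' ≃ Quad (κ × κ') where
  toFun a := ((a.1.1, a.2.1), (a.1.2.1, a.2.2.1), (a.1.2.2.1, a.2.2.2.1), (a.1.2.2.2, a.2.2.2.2))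
  invFun b := ((b.1.1, b.2.1.1, b.2.2.1.1, b.2.2.2.1), (b.1.2, b.2.1.2, b.2.2.1.2, b.2.2.2.2))
  left_inv _ := rfl
  right_inv _ := rfl

/-- This factorization keeps the averaged functionals products over sites, although the gate acts
jointly on two of them. -/
lemma pairing_quadZip {κ κ' : Type} [DecidableEq κ] [DecidableEq κ'] (l : Bool) (a : Quad κ)
    (a' : Quad κ') : pairing l (quadZip (a, a')) = pairing l a * pairing l a' := by
  cases l <;> simp [pairing, quadZip, ite_and] <;> split_ifs <;> simp

lemma sum_quad {κ : Type} [Fintype κ] (f₁ f₂ f₃ f₄ : κ → ℂ) :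
    (∑ b, f₁ b) * ((∑ b, f₂ b) * ((∑ b, f₃ b) * ∑ b, f₄ b)) =
      ∑ b : Quad κ, f₁ b.1 * (f₂ b.2.1 * (f₃ b.2.2.1 * f₄ b.2.2.2)) := by
  simp only [Fintype.sum_prod_type, ← Finset.sum_mul, ← Finset.mul_sum]

/-- The tensor `ψ ⊗ ψ ⊗ ψ̄ ⊗ ψ̄`, with the four indices of each site grouped together. -/
def copies (ψ : (Fin n → Fin q) → ℂ) (a : Fin n → Quad (Fin q)) : ℂ :=
  ψ (fun k => (a k).1) * (ψ (fun k => (a k).2.1) *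
    (star (ψ fun k => (a k).2.2.1) * star (ψ fun k => (a k).2.2.2)))

lemma update_update_comp {β γ : Type} (g : β → γ) (a : Fin n → β) (i j : Fin n) (b b' : β) :
    (fun k => g (Function.update (Function.update a i b) j b' k)) =
      Function.update (Function.update (fun k => g (a k)) i (g b)) j (g b') := by
  ext k
  by_cases hkj : k = j
  · subst hkj; simp
  · by_cases hki : k = i
    · subst hki; simp [hkj]
    · simp [hkj, hki]

lemma copies_embed_mulVec {i j : Fin n} (hij : i ≠ j) (G : TwoSiteOp q)
    (ψ : (Fin n → Fin q) → ℂ) (a : Fin n → Quad (Fin q)) :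
    copies (embed i j G *ᵥ ψ) a = ∑ b : Quad (Fin q) × Quad (Fin q),
      momentMat G (quadZip (a i, a j)) (quadZip b) *
        copies ψ (Function.update (Function.update a i b.1) j b.2) := by
  rw [← Equiv.sum_comp quadZip.symm]
  simp only [copies, embed_mulVec hij, star_sum, sum_quad, Equiv.apply_symm_apply]
  refine Finset.sum_congr rfl fun b _ => ?_
  have h1 := update_update_comp (fun c : Quad (Fin q) => c.1) a i j
  have h2 := update_update_comp (fun c : Quad (Fin q) => c.2.1) a i j
  have h3 := update_update_comp (fun c : Quad (Fin q) => c.2.2.1) a i j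
  have h4 := update_update_comp (fun c : Quad (Fin q) => c.2.2.2) a i j
  simp only [h1, h2, h3, h4, momentMat_apply, star_mul']
  simp only [quadZip, Equiv.coe_fn_mk, Equiv.coe_fn_symm_mk]
  ring

/-- The value of the product functional `⊗ O_k` on `ψ ⊗ ψ ⊗ ψ̄ ⊗ ψ̄`. -/
def expval (ψ : (Fin n → Fin q) → ℂ) (O : Fin n → Quad (Fin q) → ℂ) : ℂ :=
  ∑ a, copies ψ a * ∏ k, O k (a k)

lemma prod_update_update {i j : Fin n} (hij : i ≠ j) {β : Type} (F : Fin n → β → ℂ)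
    (a : Fin n → β) (b b' : β) :
    ∏ k, F k (Function.update (Function.update a i b) j b' k) =
      F i b * F j b' * ∏ k ∈ (Finset.univ.erase i).erase j, F k (a k) := by
  rw [← Finset.mul_prod_erase _ _ (Finset.mem_univ i),
    ← Finset.mul_prod_erase _ _ (Finset.mem_erase.mpr ⟨hij.symm, Finset.mem_univ j⟩), ← mul_assoc,
    Function.update_of_ne hij, Function.update_self, Function.update_self]
  congr 1
  refine Finset.prod_congr rfl fun k hk => ?_
  simp only [Finset.mem_erase, Finset.mem_univ, and_true] at hk
  rw [Function.update_of_ne hk.1, Function.update_of_ne hk.2]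

/-- Exchanging the values at two sites with a pair of values is a bijection. -/
lemma sum_sum_update_update {i j : Fin n} (hij : i ≠ j) {β : Type} [Fintype β] [DecidableEq β]
    (F : (Fin n → β) → (Fin n → β) → ℂ) :
    ∑ a, ∑ b : β × β, F a (Function.update (Function.update a i b.1) j b.2) =
      ∑ a, ∑ b : β × β, F (Function.update (Function.update a i b.1) j b.2) a := by
  rw [← Fintype.sum_prod_type', ← Fintype.sum_prod_type']
  have key : ∀ a : Fin n → β, ∀ b : β × β, Function.update (Function.update
      (Function.update (Function.update a i b.1) j b.2) i (a i)) j (a j) = a := by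
    intro a b
    ext k
    by_cases hkj : k = j
    · subst hkj; simp
    · by_cases hki : k = i
      · subst hki; simp [hkj]
      · simp [hkj, hki]
  let e : (Fin n → β) × (β × β) → (Fin n → β) × (β × β) := fun z =>
    (Function.update (Function.update z.1 i z.2.1) j z.2.2, (z.1 i, z.1 j))
  have he : Function.Involutive e := by
    rintro ⟨a, b⟩
    simp only [e, key]
    simp [Function.update_of_ne hij]
  rw [← Equiv.sum_comp he.toPerm]
  refine Finset.sum_congr rfl fun z _ => ?_
  simp only [Function.Involutive.coe_toPerm, e, key]

lemma continuous_copies {X : Type*} [TopologicalSpace X] {ψ : X → (Fin n → Fin q) → ℂ}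
    (hψ : Continuous ψ) (a : Fin n → Quad (Fin q)) : Continuous fun V => copies (ψ V) a := by
  have h : ∀ x, Continuous fun V => ψ V x := fun x => (continuous_apply x).comp hψ
  exact (h _).mul ((h _).mul ((h _).star.mul (h _).star))

lemma continuous_expval {X : Type*} [TopologicalSpace X] {ψ : X → (Fin n → Fin q) → ℂ}
    (hψ : Continuous ψ) (O : Fin n → Quad (Fin q) → ℂ) : Continuous fun V => expval (ψ V) O :=
  continuous_finsetSum _ fun a _ => (continuous_copies hψ a).mul continuous_const

/-- Averaging over one entangling gate. -/
lemma integral_expval_embed {i j : Fin n} (hij : i ≠ j) (hq : 2 ≤ q)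
    {μ : Measure (Matrix.unitaryGroup (Fin q × Fin q) ℂ)} (hμ : IsTwoDesign μ)
    {A B : TwoSiteOp q} (hA : A ∈ Matrix.unitaryGroup (Fin q × Fin q) ℂ)
    (hB : B ∈ Matrix.unitaryGroup (Fin q × Fin q) ℂ) (ψ : (Fin n → Fin q) → ℂ)
    (O : Fin n → Quad (Fin q) → ℂ) :
    ∫ V, expval (embed i j (A * (V : TwoSiteOp q) * B) *ᵥ ψ) O ∂μ =
      ∑ l, (∑ l', wg ((q : ℂ) ^ 2) l' l * (pairing l' ⬝ᵥ O i) * (pairing l' ⬝ᵥ O j)) *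
        expval ψ (Function.update (Function.update O i (pairing l)) j (pairing l)) := by
  have := hμ.1
  have hcard : Fintype.card (Fin q × Fin q) = q ^ 2 := by simp [sq]
  have hι : 2 ≤ Fintype.card (Fin q × Fin q) := by rw [hcard]; nlinarith
  have hint : ∀ a b, Integrable (fun V : Matrix.unitaryGroup (Fin q × Fin q) ℂ =>
      momentMat (A * (V : TwoSiteOp q) * B) a b) μ := by
    intro a b
    refine integrable_of_continuous ?_ _
    simp only [momentMat_mul, Matrix.mul_apply]
    exact continuous_finsetSum _ fun c _ => (continuous_finsetSum _ fun e _ =>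
      continuous_const.mul (continuous_momentMat_apply e c)).mul continuous_const
  simp only [expval, copies_embed_mulVec hij]
  rw [integral_finsetSum _ fun a _ => (integrable_finsetSum _ fun b _ =>
    (hint _ _).mul_const _).mul_const _]
  have h1 : ∀ a : Fin n → Quad (Fin q), ∫ V : Matrix.unitaryGroup (Fin q × Fin q) ℂ,
      (∑ b : Quad (Fin q) × Quad (Fin q),
        momentMat (A * (V : TwoSiteOp q) * B) (quadZip (a i, a j)) (quadZip b) *
        copies ψ (Function.update (Function.update a i b.1) j b.2)) * ∏ k, O k (a k) ∂μ =
      ∑ b : Quad (Fin q) × Quad (Fin q), (∑ l', ∑ l, wg ((q : ℂ) ^ 2) l' l *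
        (pairing l' (a i) * pairing l' (a j)) *
        pairing l (quadZip (Function.update (Function.update a i b.1) j b.2 i,
          Function.update (Function.update a i b.1) j b.2 j))) *
        copies ψ (Function.update (Function.update a i b.1) j b.2) * ∏ k, O k (a k) := by
    intro a
    rw [integral_mul_const, integral_finsetSum _ fun b _ => (hint _ _).mul_const _,
      Finset.sum_mul]
    refine Finset.sum_congr rfl fun b _ => ?_
    rw [integral_mul_const, integral_momentMat_mul_mul hι hμ hA hB, hcard]
    simp [pairing_quadZip, Function.update_of_ne hij]
  simp only [h1]
  -- After this change of variables `copies ψ` sits at the free index a. The sum over b contracts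
  -- the output pairing with the functionals at i and j, while the input pairing replaces them.
  rw [sum_sum_update_update hij (fun a a' => (∑ l', ∑ l, wg ((q : ℂ) ^ 2) l' l *
        (pairing l' (a i) * pairing l' (a j)) * pairing l (quadZip (a' i, a' j))) *
        copies ψ a' * ∏ k, O k (a k))]
  simp only [Finset.mul_sum]
  conv_rhs => rw [Finset.sum_comm]
  refine Finset.sum_congr rfl fun a _ => ?_
  simp only [prod_update_update hij (fun k => O k), Function.update_of_ne hij,
    Function.update_self, pairing_quadZip]
  have h2 : ∀ l : Bool, ∏ k, Function.update (Function.update O i (pairing l)) j (pairing l) k (a k)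
      = pairing l (a i) * pairing l (a j) *
        ∏ k ∈ (Finset.univ.erase i).erase j, O k (a k) := fun l =>
    prod_update_update hij (fun k f => f (a k)) O (pairing l) (pairing l)
  have h3 : ∀ l', (pairing l' ⬝ᵥ O i) * (pairing l' ⬝ᵥ O j) =
      ∑ b : Quad (Fin q) × Quad (Fin q),
        (pairing l' b.1 * O i b.1) * (pairing l' b.2 * O j b.2) := fun l' => by
    rw [dotProduct, dotProduct, Finset.sum_mul_sum, ← Fintype.sum_prod_type']
  simp only [h2, mul_assoc, h3, Fintype.sum_bool, Finset.mul_sum, Finset.sum_mul, add_mul,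
    ← Finset.sum_add_distrib]
  refine Finset.sum_congr rfl fun b _ => by ring

end SecondMoment

/-! ### Finite expectations of complex functions. -/

section Expectation

variable {α β : Type} [Fintype α] [Fintype β]

/-- The expectation of a complex function on a finite type. -/
def expect (P : PMF α) (f : α → ℂ) : ℂ := ∑ a, ((P a).toReal : ℂ) * f a

lemma expect_bind (P : PMF α) (K : α → PMF β) (f : β → ℂ) :
    expect (P.bind K) f = expect P fun a => expect (K a) f := by
  simp only [expect, PMF.bind_apply, tsum_fintype, Finset.mul_sum]
  rw [Finset.sum_comm]
  refine Finset.sum_congr rfl fun b _ => ?_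
  rw [ENNReal.toReal_sum fun a _ => ENNReal.mul_ne_top (P.apply_ne_top a) ((K a).apply_ne_top b)]
  simp [ENNReal.toReal_mul, Finset.sum_mul, mul_assoc]

lemma expect_pure (a : α) (f : α → ℂ) : expect (PMF.pure a) f = f a := by
  classical
  simp only [expect, PMF.pure_apply]
  rw [Finset.sum_eq_single a (fun b _ hb => by simp [hb]) (by simp)]
  simp

lemma expect_map (P : PMF α) (g : α → β) (f : β → ℂ) :
    expect (P.map g) f = expect P fun a => f (g a) := by
  rw [PMF.map, expect_bind]
  simp [expect_pure]

lemma expect_mul_left (P : PMF α) (c : ℂ) (f : α → ℂ) :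
    (expect P fun a => c * f a) = c * expect P f := by
  simp only [expect, Finset.mul_sum]
  exact Finset.sum_congr rfl fun a _ => by ring

lemma expect_sum {κ : Type} (s : Finset κ) (P : PMF α) (f : κ → α → ℂ) :
    (expect P fun a => ∑ i ∈ s, f i a) = ∑ i ∈ s, expect P (f i) := by
  simp only [expect, Finset.mul_sum]
  exact Finset.sum_comm

lemma coin_true {r : ℝ} (h0 : 0 ≤ r) (h1 : r ≤ 1) : (coin r true).toReal = r := by
  simp [coin, h0, h1]

lemma coin_false {r : ℝ} (h0 : 0 ≤ r) (h1 : r ≤ 1) : (coin r false).toReal = 1 - r := by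
  simp [coin, h0, h1]

lemma expect_coin {r : ℝ} (h0 : 0 ≤ r) (h1 : r ≤ 1) (f : Bool → ℂ) :
    expect (coin r) f = r * f true + (1 - r) * f false := by
  simp [expect, coin_true h0 h1, coin_false h0 h1]

end Expectation

/-! ### Duality between gate averaging and the biased walk. -/

section SecondMoment

variable {n q p : ℕ}

/-- The state prepared by a sequence of blocks from `|0ⁿ⟩`. -/
def finalState [NeZero q] {m : ℕ} (blk : Fin m → Block n q p) (V : Realization q m)
    (θ : Fin p → ℝ) : (Fin n → Fin q) → ℂ :=
  (List.finRange m).foldl (fun ψ t => embed (blk t).fst (blk t).snd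
    (seqMat (blk t).post θ * (V t : TwoSiteOp q) * seqMat (blk t).pre θ) *ᵥ ψ)
    (Pi.single (fun _ => 0) 1)

lemma finalState_succ [NeZero q] {m : ℕ} (blk : Fin (m + 1) → Block n q p)
    (V : Realization q (m + 1)) (θ : Fin p → ℝ) :
    finalState blk V θ = embed (blk (Fin.last m)).fst (blk (Fin.last m)).snd
      (seqMat (blk (Fin.last m)).post θ * (V (Fin.last m) : TwoSiteOp q) *
        seqMat (blk (Fin.last m)).pre θ) *ᵥ
      finalState (fun t => blk t.castSucc) (fun t => V t.castSucc) θ := by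
  simp [finalState, List.finRange_succ_last, List.foldl_map]

/-- The law of the configuration of the walk after a sequence of blocks. -/
def walk {m : ℕ} (blk : Fin m → Block n q p) : PMF (Config n) :=
  (List.finRange m).foldl
    (fun P t => P.bind (gateStep q (blk t).fst (blk t).snd)) (initConfig n q)

lemma walk_succ {m : ℕ} (blk : Fin (m + 1) → Block n q p) :
    walk blk = (walk fun t => blk t.castSucc).bind
      (gateStep q (blk (Fin.last m)).fst (blk (Fin.last m)).snd) := by
  simp [walk, List.finRange_succ_last, List.foldl_map]

/-- The value of a single-site functional on the normalized pairing with a given label. -/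
def siteValue (b : Bool) (O : Quad (Fin q) → ℂ) : ℂ :=
  if b then (pairing true ⬝ᵥ O) / q else (pairing false ⬝ᵥ O) / (q : ℂ) ^ 2

/-- The normalization gives both labels the value 1 on the I pairing. On the S pairing they give q
and 1/q, which multiply to 1 for two different labels. -/
lemma siteValue_pairing (hq : 2 ≤ q) (b l : Bool) :
    siteValue b (pairing l : Quad (Fin q) → ℂ) =
      if l then (if b then (q : ℂ) else 1 / q) else 1 := by
  have hq0 : (q : ℂ) ≠ 0 := by exact_mod_cast (by omega : q ≠ 0)
  cases b <;> cases l <;> simp [siteValue, pairing_dotProduct_pairing, hq0] <;> field_simp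

/-- The functionals that cannot distinguish `|0⟩⟨0|` from the averaged initial labels. -/
def IsInitial [NeZero q] (O : Quad (Fin q) → ℂ) : Prop :=
  O (0, 0, 0, 0) = expect (coin (1 / ((q : ℝ) + 1))) fun b => siteValue b O

lemma one_div_succ_mem (x : ℝ) (hx : 0 ≤ x) : 0 ≤ 1 / (x + 1) ∧ 1 / (x + 1) ≤ 1 :=
  ⟨by positivity, by rw [div_le_one (by positivity)]; linarith⟩

/-- This determines the initial bias: on the S pairing the label probability r must satisfy r·q + (1
- r)/q = 1, that is r = 1/(q+1). A general functional fails this condition, so each site must first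
be met by a gate. -/
lemma isInitial_pairing [NeZero q] (hq : 2 ≤ q) (l : Bool) :
    IsInitial (pairing l : Quad (Fin q) → ℂ) := by
  obtain ⟨h0, h1⟩ := one_div_succ_mem (q : ℝ) (by positivity)
  have hq0 : (q : ℂ) ≠ 0 := by exact_mod_cast (by omega : q ≠ 0)
  have hq1 : (q : ℂ) + 1 ≠ 0 := by exact_mod_cast (by omega : q + 1 ≠ 0)
  rw [IsInitial, expect_coin h0 h1]
  simp only [siteValue_pairing hq]
  cases l <;> simp [pairing]
  field_simp
  ring

/-- One step of the walk, dually on products of single-site functionals. -/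
lemma expect_gateStep (hq : 2 ≤ q) {i j : Fin n} (hij : i ≠ j) (γ : Config n)
    (O : Fin n → Quad (Fin q) → ℂ) :
    (expect (gateStep q i j γ) fun γ' => ∏ k, siteValue (γ' k) (O k)) =
      ∑ l, (∑ l', wg ((q : ℂ) ^ 2) l' l * (pairing l' ⬝ᵥ O i) * (pairing l' ⬝ᵥ O j)) *
        ∏ k, siteValue (γ k)
          (Function.update (Function.update O i (pairing l)) j (pairing l) k) := by
  obtain ⟨h0, h1⟩ := one_div_succ_mem ((q : ℝ) ^ 2) (by positivity)
  have hq0 : (q : ℂ) ≠ 0 := by exact_mod_cast (by omega : q ≠ 0)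
  have hq1 : (q : ℂ) ^ 2 + 1 ≠ 0 := by exact_mod_cast (by positivity : q ^ 2 + 1 ≠ 0)
  have hq4 : (q : ℂ) ^ 2 - 1 ≠ 0 := by
    rw [sub_ne_zero]
    have : 1 < q ^ 2 := by nlinarith
    exact_mod_cast this.ne'
  -- For a pair of sites d = q², and d² - 1 = (q² - 1)(q² + 1); the second factor becomes the
  -- denominator of the flip probability.
  have hwg : ∀ l l', wg ((q : ℂ) ^ 2) l l' =
      if l = l' then 1 / (((q : ℂ) ^ 2 - 1) * ((q : ℂ) ^ 2 + 1))
      else -1 / ((q : ℂ) ^ 2 * ((q ^ 2 - 1) * (q ^ 2 + 1))) := by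
    intro l l'
    have : ((q : ℂ) ^ 2) ^ 2 - 1 = (q ^ 2 - 1) * (q ^ 2 + 1) := by ring
    rw [wg, this]
    split_ifs
    · field_simp
    · rfl
  have hR : ∀ l : Bool, ∏ k, siteValue (γ k)
      (Function.update (Function.update O i (pairing l)) j (pairing l) k) =
      siteValue (γ i) (pairing l : Quad (Fin q) → ℂ) *
        siteValue (γ j) (pairing l : Quad (Fin q) → ℂ) *
        ∏ k ∈ (Finset.univ.erase i).erase j, siteValue (γ k) (O k) := fun l =>
    prod_update_update hij (fun k f => siteValue (γ k) f) O (pairing l) (pairing l)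
  have hγ : ∏ k, siteValue (γ k) (O k) = siteValue (γ i) (O i) * siteValue (γ j) (O j) *
        ∏ k ∈ (Finset.univ.erase i).erase j, siteValue (γ k) (O k) := by
    rw [← Finset.mul_prod_erase _ _ (Finset.mem_univ i),
      ← Finset.mul_prod_erase _ _ (Finset.mem_erase.mpr ⟨hij.symm, Finset.mem_univ j⟩),
      ← mul_assoc]
  simp only [hR, siteValue_pairing hq, hwg, Fintype.sum_bool]
  -- For equal labels the Weingarten matrix inverts the Gram matrix, so only that same label
  -- survives.
  by_cases h : γ i = γ j
  · rw [gateStep, if_pos h, expect_pure, hγ, h]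
    generalize ∏ k ∈ (Finset.univ.erase i).erase j, siteValue (γ k) (O k) = r
    simp only [siteValue]
    generalize pairing true ⬝ᵥ O i = x
    generalize pairing true ⬝ᵥ O j = y
    generalize pairing false ⬝ᵥ O i = z
    generalize pairing false ⬝ᵥ O j = w
    cases γ j <;> simp <;> field_simp <;> ring
  · rw [gateStep, if_neg h, expect_map, expect_coin h0 h1]
    simp only [prod_update_update hij (fun k b => siteValue b (O k))]
    -- For different labels both input pairings have value 1. The row sum of `wg` is 1/(q²(q²+1)).
    -- Multiplied by the normalizations q² for (S,S) and q⁴ for (I,I), it gives the probabilities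
    -- 1/(q²+1) and q²/(q²+1).
    have hs : ((if γ i = true then (q : ℂ) else 1 / q) * if γ j = true then (q : ℂ) else 1 / q) =
        1 := by
      cases hi : γ i <;> cases hj : γ j <;> simp [hi, hj, hq0] at h ⊢
    generalize ∏ k ∈ (Finset.univ.erase i).erase j, siteValue (γ k) (O k) = r
    simp only [siteValue]
    generalize pairing true ⬝ᵥ O i = x
    generalize pairing true ⬝ᵥ O j = y
    generalize pairing false ⬝ᵥ O i = z
    generalize pairing false ⬝ᵥ O j = w
    simp only [if_true, hs]
    simp
    field_simp
    ring

end SecondMoment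

/-! ### Unitarity and continuity of circuits, and the induction over gates. -/

section Gates

variable {n q p : ℕ}

/-- Lets continuous functions of several gates be measurable for the product σ-algebra, so that
compactness yields integrability. -/
instance secondCountableTopology_unitaryGroup {ι : Type} [Fintype ι] [DecidableEq ι] :
    SecondCountableTopology (Matrix.unitaryGroup ι ℂ) := by
  have : SecondCountableTopology (Matrix ι ι ℂ) :=
    inferInstanceAs (SecondCountableTopology (ι → ι → ℂ))
  exact TopologicalSpace.Subtype.secondCountableTopology _

lemma exp_smul_mem_unitaryGroup {ι : Type} [Fintype ι] [DecidableEq ι] {A : Matrix ι ι ℂ}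
    (hA : A.IsHermitian) (t : ℝ) :
    NormedSpace.exp ((-Complex.I * (t : ℂ)) • A) ∈ Matrix.unitaryGroup ι ℂ := by
  have h : ((-Complex.I * (t : ℂ)) • A).conjTranspose = -((-Complex.I * (t : ℂ)) • A) := by
    rw [Matrix.conjTranspose_smul, hA.eq, ← neg_smul]
    simp
  generalize (-Complex.I * (t : ℂ)) • A = X at h ⊢
  rw [Matrix.mem_unitaryGroup_iff, Matrix.star_eq_conjTranspose, ← Matrix.exp_conjTranspose, h,
    ← Matrix.exp_add_of_commute _ _ ((Commute.refl X).neg_right), add_neg_cancel,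
    NormedSpace.exp_zero]

lemma continuous_exp_matrix {ι : Type} [Fintype ι] [DecidableEq ι] :
    Continuous (NormedSpace.exp : Matrix ι ι ℂ → Matrix ι ι ℂ) := by
  let _ : NormedRing (Matrix ι ι ℂ) := Matrix.linftyOpNormedRing
  let _ : NormedAlgebra ℚ (Matrix ι ι ℂ) := Matrix.linftyOpNormedAlgebra
  let _ : NormedAlgebra ℂ (Matrix ι ι ℂ) := Matrix.linftyOpNormedAlgebra
  have := FiniteDimensional.complete ℂ (Matrix ι ι ℂ)
  exact NormedSpace.exp_continuous

lemma ParamGate.mat_mem (g : ParamGate q p) (θ : Fin p → ℝ) :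
    g.mat θ ∈ Matrix.unitaryGroup (Fin q × Fin q) ℂ :=
  mul_mem (mul_mem g.left.2 (exp_smul_mem_unitaryGroup g.isHermitian _)) g.right.2

lemma ParamGate.continuous_mat (g : ParamGate q p) : Continuous g.mat := by
  unfold ParamGate.mat
  refine (continuous_const.mul (continuous_exp_matrix.comp ?_)).mul continuous_const
  exact (continuous_const.mul (Complex.continuous_ofReal.comp (continuous_apply _))).smul
    continuous_const

lemma seqMat_mem (l : List (ParamGate q p)) (θ : Fin p → ℝ) :
    seqMat l θ ∈ Matrix.unitaryGroup (Fin q × Fin q) ℂ := by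
  unfold seqMat
  induction l using List.reverseRecOn with
  | nil => exact one_mem _
  | append_singleton l g ih =>
    rw [List.foldl_append]
    exact mul_mem (g.mat_mem θ) ih

lemma continuous_seqMat (l : List (ParamGate q p)) : Continuous (seqMat l) := by
  unfold seqMat
  induction l using List.reverseRecOn with
  | nil => exact continuous_const
  | append_singleton l g ih =>
    simp only [List.foldl_append]
    exact g.continuous_mat.mul ih

lemma continuous_embed (i j : Fin n) : Continuous (embed (q := q) i j) := by
  refine continuous_matrix fun x y => ?_
  unfold embed
  split_ifs
  · exact continuous_id.matrix_elem _ _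
  · exact continuous_const

lemma continuous_embed_mulVec {X : Type*} [TopologicalSpace X] (i j : Fin n)
    {A B : X → TwoSiteOp q} {V : X → Matrix.unitaryGroup (Fin q × Fin q) ℂ}
    {ψ : X → (Fin n → Fin q) → ℂ} (hA : Continuous A) (hB : Continuous B) (hV : Continuous V)
    (hψ : Continuous ψ) :
    Continuous fun z => embed i j (A z * (V z : TwoSiteOp q) * B z) *ᵥ ψ z := by
  have h1 : Continuous fun z => A z * (V z : TwoSiteOp q) * B z :=
    (hA.mul (continuous_subtype_val.comp hV)).mul hB
  have h2 : Continuous fun z => embed i j (A z * (V z : TwoSiteOp q) * B z) :=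
    (continuous_embed i j).comp h1
  exact h2.matrix_mulVec hψ

lemma continuous_finalState [NeZero q] {X : Type*} [TopologicalSpace X] :
    ∀ {m : ℕ} (blk : Fin m → Block n q p) {V : X → Realization q m} {θ : X → Fin p → ℝ}
      (_ : Continuous V) (_ : Continuous θ), Continuous fun z => finalState blk (V z) (θ z)
  | 0, _, _, _, _, _ => continuous_const
  | m + 1, blk, V, θ, hV, hθ => by
    have hV' : ∀ t, Continuous fun z => V z t := fun t => (continuous_apply t).comp hV
    have h1 : Continuous fun z => finalState (fun t => blk t.castSucc)
        (fun t => V z t.castSucc) (θ z) :=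
      continuous_finalState (fun t => blk t.castSucc) (continuous_pi fun t => hV' _) hθ
    simp only [finalState_succ]
    exact continuous_embed_mulVec _ _ ((continuous_seqMat _).comp hθ)
      ((continuous_seqMat _).comp hθ) (hV' _) h1

lemma expval_single [NeZero q] (O : Fin n → Quad (Fin q) → ℂ) :
    expval (Pi.single (fun _ => 0) 1) O = ∏ k, O k (0, 0, 0, 0) := by
  rw [expval, Finset.sum_eq_single fun _ => (0, 0, 0, 0)]
  · simp [copies]
  · intro a _ ha
    have h : ∀ x : Fin n → Fin q, x ≠ (fun _ => 0) →
        (Pi.single (fun _ => 0) 1 : (Fin n → Fin q) → ℂ) x = 0 := fun x hx =>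
      Pi.single_eq_of_ne hx _
    by_cases h1 : (fun k => (a k).1) = fun _ => 0
    · by_cases h2 : (fun k => (a k).2.1) = fun _ => 0
      · by_cases h3 : (fun k => (a k).2.2.1) = fun _ => 0
        · by_cases h4 : (fun k => (a k).2.2.2) = fun _ => 0
          · exact absurd (funext fun k => Prod.ext (congrFun h1 k) (Prod.ext (congrFun h2 k)
              (Prod.ext (congrFun h3 k) (congrFun h4 k)))) ha
          · simp [copies, h _ h4]
        · simp [copies, h _ h3]
      · simp [copies, h _ h2]
    · simp [copies, h _ h1]
  · simp

lemma initConfig_apply (γ : Config n) :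
    initConfig n q γ = ∏ k, coin (1 / ((q : ℝ) + 1)) (γ k) := rfl

lemma expect_initConfig (f : Fin n → Bool → ℂ) :
    (expect (initConfig n q) fun γ => ∏ k, f k (γ k)) =
      ∏ k, expect (coin (1 / ((q : ℝ) + 1))) (f k) := by
  simp only [expect, initConfig_apply, ENNReal.toReal_prod, Complex.ofReal_prod,
    ← Finset.prod_mul_distrib]
  exact (Fintype.prod_sum fun k b => ((coin (1 / ((q : ℝ) + 1)) b).toReal : ℂ) * f k b).symm

/-- Induction that removes the last gate, in the Heisenberg direction. Averaging it puts a pairing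
at its two sites, and pairings are initial, so the alternative "met by a gate or initial" passes to
the shorter circuit. With no gates left all functionals are initial and both sides are products over
sites. -/
theorem integral_expval_finalState [NeZero q] (hq : 2 ≤ q) (θ : Fin p → ℝ) :
    ∀ {m : ℕ} (blk : Fin m → Block n q p)
      (μ : Fin m → Measure (Matrix.unitaryGroup (Fin q × Fin q) ℂ)) (_ : ∀ t, IsTwoDesign (μ t))
      (O : Fin n → Quad (Fin q) → ℂ)
      (_ : ∀ k, (∃ t, k = (blk t).fst ∨ k = (blk t).snd) ∨ IsInitial (O k)),
      ∫ V, expval (finalState blk V θ) O ∂(Measure.pi μ) =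
        expect (walk blk) fun γ => ∏ k, siteValue (γ k) (O k)
  | 0, blk, μ, hμ, O, hO => by
    have hprob : ∀ t, IsProbabilityMeasure (μ t) := fun t => (hμ t).1
    have hbase : ∀ k, O k (0, 0, 0, 0) =
        expect (coin (1 / ((q : ℝ) + 1))) fun b => siteValue b (O k) := fun k =>
      (hO k).resolve_left fun ⟨t, _⟩ => t.elim0
    have h1 : ∀ V, finalState blk V θ = Pi.single (fun _ => 0) 1 := fun _ => rfl
    simp only [h1, expval_single, integral_const, probReal_univ, one_smul]
    simp only [walk, List.finRange_zero, List.foldl_nil, hbase]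
    exact (expect_initConfig fun k b => siteValue b (O k)).symm
  | m + 1, blk, μ, hμ, O, hO => by
    have hprob : ∀ t, IsProbabilityMeasure (μ t) := fun t => (hμ t).1
    set i := (blk (Fin.last m)).fst
    set j := (blk (Fin.last m)).snd
    have hij : i ≠ j := (blk (Fin.last m)).ne
    set A := seqMat (blk (Fin.last m)).post θ
    set B := seqMat (blk (Fin.last m)).pre θ
    set blk' : Fin m → Block n q p := fun t => blk t.castSucc
    let g : Matrix.unitaryGroup (Fin q × Fin q) ℂ × Realization q m → ℂ := fun z =>
      expval (embed i j (A * (z.1 : TwoSiteOp q) * B) *ᵥ finalState blk' z.2 θ) O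
    have hcont : Continuous g := by
      refine continuous_expval ?_ O
      exact continuous_embed_mulVec i j continuous_const continuous_const continuous_fst
        (continuous_finalState blk' continuous_snd continuous_const)
    have hmp := measurePreserving_piFinSuccAbove μ (Fin.last m)
    have hstep : ∀ V : Realization q (m + 1), expval (finalState blk V θ) O =
        g (MeasurableEquiv.piFinSuccAbove
          (fun _ => Matrix.unitaryGroup (Fin q × Fin q) ℂ) (Fin.last m) V) := by
      intro V
      rw [finalState_succ]
      simp only [g, MeasurableEquiv.piFinSuccAbove_apply]
      congr 3
      all_goals simp
      rfl
    simp only [hstep]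
    -- Fubini with the last gate as the inner integral and the earlier gates frozen.
    rw [hmp.integral_comp' g, integral_prod_symm g (integrable_of_continuous hcont _)]
    have hA : A ∈ Matrix.unitaryGroup (Fin q × Fin q) ℂ := seqMat_mem _ _
    have hB : B ∈ Matrix.unitaryGroup (Fin q × Fin q) ℂ := seqMat_mem _ _
    simp only [g, integral_expval_embed hij hq (hμ (Fin.last m)) hA hB]
    simp only [Fin.succAbove_last]
    have hint : ∀ O' : Fin n → Quad (Fin q) → ℂ,
        Integrable (fun V : Realization q m => expval (finalState blk' V θ) O')
          (Measure.pi fun t => μ t.castSucc) := fun O' =>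
      integrable_of_continuous (continuous_expval (continuous_finalState blk'
        continuous_id continuous_const) O') _
    rw [integral_finsetSum _ fun l _ => (hint _).const_mul _]
    simp only [integral_const_mul]
    have hw : walk blk = (walk blk').bind (gateStep q i j) := walk_succ blk
    rw [hw, expect_bind]
    simp only [expect_gateStep hq hij]
    rw [expect_sum]
    refine Finset.sum_congr rfl fun l _ => ?_
    rw [expect_mul_left]
    congr 1
    refine integral_expval_finalState hq θ blk' (fun t => μ t.castSucc) (fun t => hμ _) _ ?_
    intro k
    by_cases hkj : k = j
    · right; subst hkj
      rw [Function.update_self]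
      exact isInitial_pairing hq l
    by_cases hki : k = i
    · right; subst hki
      rw [Function.update_of_ne hkj, Function.update_self]
      exact isInitial_pairing hq l
    rw [Function.update_of_ne hkj, Function.update_of_ne hki]
    refine (hO k).imp_left ?_
    rintro ⟨t, ht⟩
    induction t using Fin.lastCases with
    | last => exact absurd ht (not_or.mpr ⟨hki, hkj⟩)
    | cast t => exact ⟨t, ht⟩

end Gates

/-! ### From the squared objective to supports of strings. -/

section Objective

variable {n q m p : ℕ}

/-- Transposes a family of fourfold indices into a fourfold index of families. -/
def quadPi {κ : Type} : (Fin n → Quad κ) ≃ Quad (Fin n → κ) where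
  toFun a := (fun k => (a k).1, fun k => (a k).2.1, fun k => (a k).2.2.1, fun k => (a k).2.2.2)
  invFun b := fun k => (b.1 k, b.2.1 k, b.2.2.1 k, b.2.2.2 k)
  left_inv _ := rfl
  right_inv _ := rfl

/-- The single-site functional given by a pair of matrices. -/
def pairFunctional (A B : Matrix (Fin q) (Fin q) ℂ) (a : Quad (Fin q)) : ℂ :=
  A a.2.2.1 a.1 * star (B a.2.1 a.2.2.2)

/-- Conjugating the second factor makes the squared modulus of an expectation a sum of such terms,
and makes the S pairing produce the trace of B†A. -/
lemma expval_pairFunctional (ψ : (Fin n → Fin q) → ℂ)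
    (A B : Fin n → Matrix (Fin q) (Fin q) ℂ) :
    expval ψ (fun k => pairFunctional (A k) (B k)) =
      (star ψ ⬝ᵥ ((Matrix.of fun a b => ∏ k, A k (a k) (b k)) *ᵥ ψ)) *
        star (star ψ ⬝ᵥ ((Matrix.of fun a b => ∏ k, B k (a k) (b k)) *ᵥ ψ)) := by
  rw [expval, ← Equiv.sum_comp quadPi.symm]
  have h : ∀ A : Matrix (Fin n → Fin q) (Fin n → Fin q) ℂ, star ψ ⬝ᵥ (A *ᵥ ψ) =
      ∑ a, ∑ b, star (ψ a) * (A a b * ψ b) := fun A => by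
    simp [dotProduct, Matrix.mulVec, Finset.mul_sum]
  have hterm : ∀ b : Quad (Fin n → Fin q), copies ψ (quadPi.symm b) *
      ∏ k, pairFunctional (A k) (B k) (quadPi.symm b k) =
      (star (ψ b.2.2.1) * ((∏ k, A k (b.2.2.1 k) (b.1 k)) * ψ b.1)) *
        star (star (ψ b.2.1) * ((∏ k, B k (b.2.1 k) (b.2.2.2 k)) * ψ b.2.2.2)) := fun b => by
    simp only [copies, pairFunctional, quadPi, Equiv.coe_fn_symm_mk, Finset.prod_mul_distrib,
      star_mul', star_prod, star_star]
    ring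
  simp only [hterm, h, star_sum, Matrix.of_apply]
  rw [Finset.sum_comm (f := fun a b => star (ψ a) * ((∏ k, A k (a k) (b k)) * ψ b))]
  simp only [Fintype.sum_prod_type, ← Finset.mul_sum, ← Finset.sum_mul]

variable [NeZero q]

/-- The I pairing gives tr M_i times the conjugate of tr M_j, nonzero only for i = j = 0 because M_0
= 1. The S pairing gives tr(M_j† M_i), nonzero exactly for i = j. -/
lemma siteValue_pairFunctional (hq : 2 ≤ q) (M : OperatorBasis q) (i j : Fin (q ^ 2)) (b : Bool) :
    siteValue b (pairFunctional (M.op i) (M.op j)) =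
      if i = j ∧ (i ≠ 0 → b = true) then 1 else 0 := by
  have hq0 : (q : ℂ) ≠ 0 := by exact_mod_cast (by omega : q ≠ 0)
  have htr : ∀ i, (M.op i).trace = if i = 0 then (q : ℂ) else 0 := fun i => by
    have := M.trace_mul 0 i
    rw [M.op_zero] at this
    simpa [eq_comm] using this
  have hI : (pairing false ⬝ᵥ pairFunctional (M.op i) (M.op j)) =
      (M.op i).trace * star (M.op j).trace := by
    simp only [dotProduct, pairing, pairFunctional, Fintype.sum_prod_type, Matrix.trace,
      Matrix.diag, star_sum, Finset.sum_mul_sum]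
    simp
  have hS : (pairing true ⬝ᵥ pairFunctional (M.op i) (M.op j)) =
      ((M.op j).conjTranspose * M.op i).trace := by
    simp only [dotProduct, pairing, pairFunctional, Fintype.sum_prod_type, Matrix.trace,
      Matrix.diag, Matrix.mul_apply, Matrix.conjTranspose_apply]
    simp [mul_comm]
  cases b
  · simp only [siteValue, hI, htr]
    by_cases hi : i = 0
    · subst hi
      by_cases hj : j = 0
      · subst hj; simp; field_simp
      · simp [hj, Ne.symm hj]
    · simp [hi]
  · simp only [siteValue, hS, M.trace_mul]
    by_cases hij : i = j
    · subst hij; simp [hq0]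
    · simp [hij, Ne.symm hij]

lemma prod_siteValue_pairFunctional (hq : 2 ≤ q) (M : OperatorBasis q)
    (x y : Fin n → Fin (q ^ 2)) (γ : Config n) :
    ∏ k, siteValue (γ k) (pairFunctional (M.op (x k)) (M.op (y k))) =
      if x = y then (if ∀ k, x k ≠ 0 → γ k = true then 1 else 0) else 0 := by
  simp only [siteValue_pairFunctional hq]
  rw [Finset.prod_ite_zero]
  simp only [Finset.prod_const_one, Finset.mem_univ, true_imp_iff, forall_and, funext_iff]
  rw [ite_and]

lemma Circuit.mat_mulVec (U : Circuit n q m p) (V : Realization q m) (θ : Fin p → ℝ) :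
    U.mat V θ *ᵥ Pi.single (fun _ => 0) 1 = finalState U.block V θ := by
  unfold Circuit.mat finalState
  rw [← List.foldl_hom (fun A : QuditOp n q => A *ᵥ Pi.single (fun _ => 0) (1 : ℂ))
    (g₂ := fun ψ t => U.blockMat V θ t *ᵥ ψ) (fun A t => Matrix.mulVec_mulVec _ _ _)]
  rw [Matrix.one_mulVec]
  rfl

lemma Circuit.objective_eq (U : Circuit n q m p) (H : QuditOp n q) (V : Realization q m)
    (θ : Fin p → ℝ) : U.objective H V θ =
      (star (finalState U.block V θ) ⬝ᵥ (H *ᵥ finalState U.block V θ)).re := by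
  unfold Circuit.objective
  rw [← U.mat_mulVec, Matrix.star_mulVec, ← Matrix.dotProduct_mulVec, Matrix.mulVec_mulVec,
    Matrix.mulVec_mulVec]
  simp [mul_assoc]

lemma Circuit.objective_sq (U : Circuit n q m p) {M : OperatorBasis q}
    {c : (Fin n → Fin (q ^ 2)) → ℂ} (hH : (M.observable c).IsHermitian) (V : Realization q m)
    (θ : Fin p → ℝ) : ((U.objective (M.observable c) V θ ^ 2 : ℝ) : ℂ) =
      ∑ x, ∑ y, c x * star (c y) *
        expval (finalState U.block V θ) fun k => pairFunctional (M.op (x k)) (M.op (y k)) := by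
  rw [U.objective_eq]
  set ψ := finalState U.block V θ
  set z := star ψ ⬝ᵥ (M.observable c *ᵥ ψ) with hz
  have hreal : star z = z := by
    calc star z = star (M.observable c *ᵥ ψ) ⬝ᵥ ψ := (Matrix.star_dotProduct _ _).symm
      _ = z := by rw [Matrix.star_mulVec, hH.eq, ← Matrix.dotProduct_mulVec]
  -- Hermiticity makes z real, so its square may be written z·z̄, the form to which
  -- `expval_pairFunctional` applies.
  have hz' : ((z.re ^ 2 : ℝ) : ℂ) = z * star z := by
    have : ((z.re : ℝ) : ℂ) = z := Complex.conj_eq_iff_re.mp hreal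
    rw [hreal, Complex.ofReal_pow, this, sq]
  have hexp : z = ∑ x, c x *
      (star ψ ⬝ᵥ ((Matrix.of fun a b => ∏ k, M.op (x k) (a k) (b k)) *ᵥ ψ)) := by
    rw [hz, OperatorBasis.observable, Matrix.sum_mulVec, dotProduct_sum]
    refine Finset.sum_congr rfl fun x _ => ?_
    rw [Matrix.smul_mulVec, dotProduct_smul, smul_eq_mul]
    rfl
  rw [hz', hexp, star_sum, Finset.sum_mul_sum]
  refine Finset.sum_congr rfl fun x _ => Finset.sum_congr rfl fun y _ => ?_
  rw [expval_pairFunctional, star_mul']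
  ring

lemma Circuit.continuous_objective (U : Circuit n q m p) (H : QuditOp n q) :
    Continuous fun z : Realization q m × (Fin p → ℝ) => U.objective H z.1 z.2 := by
  have h : Continuous fun z : Realization q m × (Fin p → ℝ) => finalState U.block z.1 z.2 :=
    continuous_finalState U.block continuous_fst continuous_snd
  simp only [U.objective_eq]
  exact Complex.continuous_re.comp
    (h.star.dotProduct ((continuous_const (y := H)).matrix_mulVec h))

/-- For fixed parameters, the second moment over the entangling gates is the average of the
squared coefficients over the strings supported in the final configuration of the walk. -/
theorem Circuit.integral_objective_sq (U : Circuit n q m p) (hq : 2 ≤ q)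
    {μ : Fin m → Measure (Matrix.unitaryGroup (Fin q × Fin q) ℂ)} (hμ : ∀ t, IsTwoDesign (μ t))
    {M : OperatorBasis q} {c : (Fin n → Fin (q ^ 2)) → ℂ} (hH : (M.observable c).IsHermitian)
    (θ : Fin p → ℝ) :
    ((∫ V, U.objective (M.observable c) V θ ^ 2 ∂(Measure.pi μ) : ℝ) : ℂ) =
      ∑ x, (‖c x‖ ^ 2 : ℂ) * expect U.finalConfig fun γ =>
        if ∀ k, x k ≠ 0 → γ k = true then 1 else 0 := by
  have hprob : ∀ t, IsProbabilityMeasure (μ t) := fun t => (hμ t).1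
  rw [← integral_complex_ofReal]
  simp only [U.objective_sq hH]
  have hint : ∀ O : Fin n → Quad (Fin q) → ℂ,
      Integrable (fun V => expval (finalState U.block V θ) O) (Measure.pi μ) := fun O =>
    integrable_of_continuous (continuous_expval
      (continuous_finalState U.block continuous_id continuous_const) O) _
  rw [integral_finsetSum _ fun x _ => integrable_finsetSum _ fun y _ => (hint _).const_mul _]
  refine Finset.sum_congr rfl fun x _ => ?_
  rw [integral_finsetSum _ fun y _ => (hint _).const_mul _]
  simp only [integral_const_mul]
  have hval : ∀ y, ∫ V, expval (finalState U.block V θ)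
      (fun k => pairFunctional (M.op (x k)) (M.op (y k))) ∂(Measure.pi μ) =
      expect U.finalConfig fun γ => if x = y then
        (if ∀ k, x k ≠ 0 → γ k = true then 1 else 0) else 0 := fun y => by
    -- Every site is met by a gate, so the functionals M_x, M_y need not be initial themselves.
    rw [integral_expval_finalState hq θ U.block μ hμ _ fun k => Or.inl (U.covers k)]
    simp only [prod_siteValue_pairFunctional hq]
    rfl
  simp only [hval]
  rw [Finset.sum_eq_single x]
  · simp only [if_true]
    congr 1
    rw [Complex.star_def, Complex.mul_conj, Complex.normSq_eq_norm_sq]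
    push_cast
    rfl
  · intro y _ hy
    simp [Ne.symm hy, expect]
  · simp

/-- The average over the gates is the same for every θ, so after exchanging the integrals the
average over θ is that of a constant. -/
theorem Circuit.secondMoment_eq (U : Circuit n q m p) (hq : 2 ≤ q)
    {μ : Fin m → Measure (Matrix.unitaryGroup (Fin q × Fin q) ℂ)} (hμ : ∀ t, IsTwoDesign (μ t))
    {M : OperatorBasis q} {c : (Fin n → Fin (q ^ 2)) → ℂ} (hH : (M.observable c).IsHermitian) :
    (U.secondMoment μ (M.observable c) : ℂ) =
      ∑ x, (‖c x‖ ^ 2 : ℂ) * expect U.finalConfig fun γ =>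
        if ∀ k, x k ≠ 0 → γ k = true then 1 else 0 := by
  have hprob : ∀ t, IsProbabilityMeasure (μ t) := fun t => (hμ t).1
  set s : Set (Fin p → ℝ) := Set.Icc (0 : Fin p → ℝ) (fun _ => 2 * Real.pi)
  set r : ℝ := ∫ V, U.objective (M.observable c) V 0 ^ 2 ∂(Measure.pi μ) with hr
  have hconst : ∀ θ, ∫ V, U.objective (M.observable c) V θ ^ 2 ∂(Measure.pi μ) = r := fun θ => by
    rw [hr]
    exact_mod_cast (U.integral_objective_sq hq hμ hH θ).trans
      (U.integral_objective_sq hq hμ hH 0).symm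
  have hs : volume.real s ≠ 0 := by
    rw [measureReal_def, Real.volume_Icc_pi_toReal (fun _ => by positivity)]
    exact Finset.prod_ne_zero_iff.mpr fun _ _ => by simp [Real.pi_ne_zero]
  have hfin : volume s ≠ ⊤ := isCompact_Icc.measure_lt_top.ne
  have hint : Integrable (Function.uncurry fun (V : Realization q m) (θ : Fin p → ℝ) =>
      U.objective (M.observable c) V θ ^ 2) ((Measure.pi μ).prod (volume.restrict s)) := by
    have hr : (Measure.pi μ).prod (volume.restrict s) =
        ((Measure.pi μ).prod volume).restrict (Set.univ ×ˢ s) := by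
      rw [← Measure.prod_restrict, Measure.restrict_univ]
    rw [hr]
    exact ((U.continuous_objective _).pow 2).continuousOn.integrableOn_compact
      (isCompact_univ.prod isCompact_Icc)
  have : U.secondMoment μ (M.observable c) = r := by
    unfold Circuit.secondMoment
    simp only [setAverage_eq, smul_eq_mul]
    rw [integral_const_mul, integral_integral_swap hint]
    simp only [hconst]
    rw [setIntegral_const, smul_eq_mul, inv_mul_cancel_left₀ hs]
  rw [this, hr]
  exact U.integral_objective_sq hq hμ hH 0

end Objective

/-! ### Hoeffding's inequality for sums of independent coins. -/

section Concentration

lemma tsum_bind_mul {α β : Type*} (P : PMF α) (K : α → PMF β) (f : β → ℝ≥0∞) :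
    ∑' b, (P.bind K) b * f b = ∑' a, P a * ∑' b, K a b * f b := by
  simp only [PMF.bind_apply, ← ENNReal.tsum_mul_right, ← ENNReal.tsum_mul_left]
  rw [ENNReal.tsum_comm]
  simp only [mul_assoc]

lemma tsum_pure_mul {α : Type*} (a : α) (f : α → ℝ≥0∞) : ∑' b, PMF.pure a b * f b = f a := by
  classical
  rw [tsum_eq_single a fun b hb => by simp [PMF.pure_apply, hb]]
  simp

lemma tsum_map_mul {α β : Type*} (P : PMF α) (g : α → β) (f : β → ℝ≥0∞) :
    ∑' b, (P.map g) b * f b = ∑' a, P a * f (g a) := by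
  rw [PMF.map, tsum_bind_mul]
  simp only [Function.comp, tsum_pure_mul]

lemma toOuterMeasure_le_tsum {α : Type*} (P : PMF α) (s : Set α) (f : α → ℝ≥0∞)
    (hf : ∀ a ∈ s, 1 ≤ f a) : P.toOuterMeasure s ≤ ∑' a, P a * f a := by
  rw [PMF.toOuterMeasure_apply]
  refine ENNReal.tsum_le_tsum fun a => ?_
  by_cases ha : a ∈ s
  · rw [Set.indicator_of_mem ha]
    exact le_mul_of_one_le_right' (hf a ha)
  · rw [Set.indicator_of_notMem ha]
    exact zero_le

/-- The moment generating function of a coin. -/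
lemma sum_bool_exp_le (B : PMF Bool) (t : ℝ) :
    ∑' b, B b * ENNReal.ofReal (Real.exp (t * if b then 1 else 0)) ≤
      ENNReal.ofReal (Real.exp ((B true).toReal * t + t ^ 2 / 8)) := by
  set X : Bool → ℝ := fun b => if b then 1 else 0 with hX
  set r := (B true).toReal with hr
  have hmean : ∫ b, X b ∂B.toMeasure = r := by
    rw [PMF.integral_eq_sum]
    simp [hX, hr]
  -- Hoeffding's lemma: a variable in [0,1] is sub-Gaussian with variance proxy 1/4, whence the
  -- exponent t²/8.
  have h := (ProbabilityTheory.hasSubgaussianMGF_of_mem_Icc (μ := B.toMeasure) (X := X)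
    (a := 0) (b := 1) (measurable_of_finite X).aemeasurable
    (Filter.Eventually.of_forall fun b => by cases b <;> simp [hX])).mgf_le t
  rw [hmean, ProbabilityTheory.mgf, PMF.integral_eq_sum] at h
  rw [tsum_fintype]
  have h1 : ∀ b, B b * ENNReal.ofReal (Real.exp (t * if b then 1 else 0)) =
      ENNReal.ofReal ((B b).toReal * Real.exp (t * X b)) := fun b => by
    rw [ENNReal.ofReal_mul ENNReal.toReal_nonneg, ENNReal.ofReal_toReal (B.apply_ne_top b)]
  simp only [h1]
  rw [← ENNReal.ofReal_sum_of_nonneg fun b _ => by positivity]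
  refine ENNReal.ofReal_le_ofReal ?_
  have h2 : ∀ b, (B b).toReal * Real.exp (t * X b) =
      Real.exp (r * t) * ((B b).toReal • Real.exp (t * (X b - r))) := fun b => by
    rw [smul_eq_mul, mul_left_comm, ← Real.exp_add]
    ring_nf
  simp only [h2, ← Finset.mul_sum]
  rw [Real.exp_add]
  refine mul_le_mul_of_nonneg_left (h.trans_eq ?_) (Real.exp_nonneg _)
  congr 1
  simp
  ring

lemma tsum_sumIID_exp_le (B : PMF Bool) (t : ℝ) (N : ℕ) :
    ∑' s, sumIID (B.map fun b => if b then 1 else 0) N s *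
        ENNReal.ofReal (Real.exp (t * (s : ℝ))) ≤
      ENNReal.ofReal (Real.exp (N * ((B true).toReal * t + t ^ 2 / 8))) := by
  induction N with
  | zero => simp [sumIID]
  | succ N ih =>
    rw [sumIID, tsum_bind_mul]
    simp only [tsum_map_mul]
    have h : ∀ s : ℕ, ∑' b, B b *
        ENNReal.ofReal (Real.exp (t * ((s + if b then 1 else 0 : ℕ) : ℝ))) ≤
        ENNReal.ofReal (Real.exp (t * (s : ℝ))) *
          ENNReal.ofReal (Real.exp ((B true).toReal * t + t ^ 2 / 8)) := fun s => by
      refine le_trans (le_of_eq ?_) (mul_le_mul_right (sum_bool_exp_le B t) _)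
      rw [← ENNReal.tsum_mul_left]
      refine tsum_congr fun b => ?_
      rw [mul_left_comm, ← ENNReal.ofReal_mul (Real.exp_nonneg _), ← Real.exp_add]
      cases b <;> simp [mul_add]
    calc _ ≤ ∑' s, sumIID (B.map fun b => if b then 1 else 0) N s *
          (ENNReal.ofReal (Real.exp (t * (s : ℝ))) *
            ENNReal.ofReal (Real.exp ((B true).toReal * t + t ^ 2 / 8))) :=
          ENNReal.tsum_le_tsum fun s => mul_le_mul_right (h s) _
      _ ≤ ENNReal.ofReal (Real.exp (N * ((B true).toReal * t + t ^ 2 / 8))) *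
            ENNReal.ofReal (Real.exp ((B true).toReal * t + t ^ 2 / 8)) := by
          simp only [← mul_assoc, ENNReal.tsum_mul_right]
          exact mul_le_mul_left ih _
      _ = _ := by
          rw [← ENNReal.ofReal_mul (Real.exp_nonneg _), ← Real.exp_add]
          congr 2
          push_cast
          ring

/-- Markov's inequality for exp(t·s). Stating the event through t·s lets the sign of t select the
upper or lower tail. -/
lemma sumIID_tail_le (B : PMF Bool) (N : ℕ) (t x : ℝ) :
    (sumIID (B.map fun b => if b then 1 else 0) N).toOuterMeasure {s | x ≤ t * (s : ℝ)} ≤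
      ENNReal.ofReal (Real.exp (N * ((B true).toReal * t + t ^ 2 / 8) - x)) := by
  refine (toOuterMeasure_le_tsum _ _ (fun s : ℕ => ENNReal.ofReal (Real.exp (t * (s : ℝ))) *
    ENNReal.ofReal (Real.exp (-x))) ?_).trans ?_
  · intro s hs
    rw [← ENNReal.ofReal_mul (Real.exp_nonneg _), ← Real.exp_add, ← ENNReal.ofReal_one]
    refine ENNReal.ofReal_le_ofReal (Real.one_le_exp ?_)
    simp only [Set.mem_ofPred_eq] at hs
    linarith
  · simp only [← mul_assoc, ENNReal.tsum_mul_right]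
    rw [sub_eq_add_neg, Real.exp_add, ENNReal.ofReal_mul (Real.exp_nonneg _)]
    exact mul_le_mul_left (tsum_sumIID_exp_le B t N) _

lemma numSamples_pos {S ε δ : ℝ} (hS : 0 < S) (hε : 0 < ε) (hδ : 0 < δ) (hδ' : δ < 1) :
    0 < numSamples S ε δ := by
  have : 0 < Real.log (2 / δ) := Real.log_pos (by rw [lt_div_iff₀ hδ]; linarith)
  exact Nat.ceil_pos.mpr (by positivity)

/-- Hoeffding's inequality for the rescaled empirical mean. -/
theorem toOuterMeasure_empirical_mean_le (B : PMF Bool) {S ε δ : ℝ} (hS : 0 < S) (hε : 0 < ε)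
    (hδ : 0 < δ) (hδ' : δ < 1) :
    (PMF.map (fun s : ℕ => S * ((numSamples S ε δ : ℕ) : ℝ)⁻¹ * (s : ℝ))
        (sumIID (B.map fun b => if b then 1 else 0) (numSamples S ε δ))).toOuterMeasure
      {y | ε < |y - S * (B true).toReal|} ≤ ENNReal.ofReal δ := by
  set N := numSamples S ε δ with hN
  set r := (B true).toReal
  set P := sumIID (B.map fun b => if b then 1 else 0) N
  have hN0 : (0 : ℝ) < N := by exact_mod_cast numSamples_pos hS hε hδ hδ'
  have hNle : (1 / 2) * Real.log (2 / δ) * (S / ε) ^ 2 ≤ N := Nat.le_ceil _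
  set a := ε / S with ha
  have ha0 : 0 < a := by positivity
  -- This is what the choice of N provides: each tail has probability at most exp(-2Na²) ≤ δ/2,
  -- where a = ε/S is the error of the unscaled mean.
  have hlog : Real.log (2 / δ) ≤ 2 * N * a ^ 2 := by
    have h : (S / ε) ^ 2 * a ^ 2 = 1 := by rw [ha]; field_simp
    have h' := mul_le_mul_of_nonneg_right hNle (sq_nonneg a)
    rw [mul_assoc, h] at h'
    linarith
  have hexp : Real.exp (-(2 * N * a ^ 2)) ≤ δ / 2 := by
    rw [← Real.log_le_log_iff (Real.exp_pos _) (by positivity), Real.log_exp,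
      ← inv_div 2 δ, Real.log_inv]
    linarith
  -- The exponent N(t²/8 - ta) is minimal at t = 4a, with value -2Na²; the lower tail uses t = -4a.
  have h1 := sumIID_tail_le B N (4 * a) (4 * a * (N * r + N * a))
  have h2 := sumIID_tail_le B N (-(4 * a)) (-(4 * a) * (N * r - N * a))
  rw [PMF.toOuterMeasure_map_apply]
  have hsub : (fun s : ℕ => S * (N : ℝ)⁻¹ * (s : ℝ)) ⁻¹' {y | ε < |y - S * r|} ⊆
      {s : ℕ | 4 * a * (N * r + N * a) ≤ 4 * a * (s : ℝ)} ∪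
        {s : ℕ | -(4 * a) * (N * r - N * a) ≤ -(4 * a) * (s : ℝ)} := by
    intro s hs
    simp only [Set.mem_preimage, Set.mem_ofPred_eq, Set.mem_union] at hs ⊢
    have hmul : S * (N : ℝ)⁻¹ * (s : ℝ) - S * r = S / N * (s - N * r) := by
      field_simp
    have hεa : ε = S / N * (N * a) := by rw [ha]; field_simp
    rcases lt_abs.mp hs with h | h
    · left
      rw [hmul, hεa] at h
      have := lt_of_mul_lt_mul_left h (by positivity)
      exact mul_le_mul_of_nonneg_left (by linarith) (by positivity)
    · right
      rw [hmul, hεa, ← mul_neg] at h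
      have := lt_of_mul_lt_mul_left h (by positivity)
      exact mul_le_mul_of_nonpos_left (by linarith) (by linarith)
  calc _ ≤ _ := P.toOuterMeasure.mono hsub
    _ ≤ _ := measure_union_le _ _
    _ ≤ ENNReal.ofReal (δ / 2) + ENNReal.ofReal (δ / 2) := by
        refine add_le_add (h1.trans (ENNReal.ofReal_le_ofReal ?_))
          (h2.trans (ENNReal.ofReal_le_ofReal ?_))
        · refine le_trans (le_of_eq ?_) hexp
          congr 1; ring
        · refine le_trans (le_of_eq ?_) hexp
          congr 1; ring
    _ = _ := by rw [← ENNReal.ofReal_add (by positivity) (by positivity), add_halves]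

end Concentration

/-! ### The mean and accuracy of the estimator. -/

section Estimator

variable {n q m p : ℕ} [NeZero q]

lemma Circuit.estimator_eq (U : Circuit n q m p) (c : (Fin n → Fin (q ^ 2)) → ℂ) (hc : c ≠ 0)
    (N : ℕ) : U.estimator c hc N =
      PMF.map (fun s : ℕ => weight c * (N : ℝ)⁻¹ * (s : ℝ)) (sumIID (U.sample c hc) N) := by
  unfold Circuit.estimator
  change PMF.map _ (PMF.map (fun s : ℕ => (s : ℝ)) _) = _
  rw [PMF.map_comp]
  rfl

/-- The event that the support of `X` lies in that of the final configuration. -/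
def Circuit.hit (U : Circuit n q m p) (c : (Fin n → Fin (q ^ 2)) → ℂ) (hc : c ≠ 0) : PMF Bool :=
  U.finalConfig.bind fun γ => (coeffPMF c hc).map fun x =>
    decide (∀ k, x k ≠ 0 → γ k = true)

lemma Circuit.sample_eq (U : Circuit n q m p) (c : (Fin n → Fin (q ^ 2)) → ℂ) (hc : c ≠ 0) :
    U.sample c hc = (U.hit c hc).map fun b => if b then 1 else 0 := by
  simp only [Circuit.sample, Circuit.hit, PMF.map_bind, PMF.map_comp]
  congr! 4
  simp

/-- The estimator is unbiased: S·Pr[X = x] = |c_x|² turns the hit probability into the walk formula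
of `Circuit.secondMoment_eq`. -/
lemma weight_mul_hit (U : Circuit n q m p) (hq : 2 ≤ q)
    {μ : Fin m → Measure (Matrix.unitaryGroup (Fin q × Fin q) ℂ)} (hμ : ∀ t, IsTwoDesign (μ t))
    {M : OperatorBasis q} {c : (Fin n → Fin (q ^ 2)) → ℂ} (hc : c ≠ 0)
    (hH : (M.observable c).IsHermitian) :
    weight c * (U.hit c hc true).toReal = U.secondMoment μ (M.observable c) := by
  have hS := weight_pos hc
  have h1 : ((U.hit c hc true).toReal : ℂ) =
      expect (U.hit c hc) fun b => if b then 1 else 0 := by simp [expect]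
  have h2 : ∀ x, ((coeffPMF c hc x).toReal : ℂ) = ‖c x‖ ^ 2 / weight c := fun x => by
    change ((ENNReal.ofReal (‖c x‖ ^ 2 / weight c)).toReal : ℂ) = _
    rw [ENNReal.toReal_ofReal (by positivity)]
    push_cast
    rfl
  have hS' : (weight c : ℂ) ≠ 0 := by exact_mod_cast hS.ne'
  have : ((weight c * (U.hit c hc true).toReal : ℝ) : ℂ) = U.secondMoment μ (M.observable c) := by
    rw [U.secondMoment_eq hq hμ hH, Complex.ofReal_mul, h1, Circuit.hit, expect_bind]
    simp only [expect_map, ← expect_mul_left, ← expect_sum]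
    congr 1
    ext γ
    simp only [expect, h2, decide_eq_true_eq]
    refine Finset.sum_congr rfl fun x _ => ?_
    field_simp
  exact_mod_cast this

theorem Circuit.toOuterMeasure_estimator_le (U : Circuit n q m p) (hq : 2 ≤ q)
    {μ : Fin m → Measure (Matrix.unitaryGroup (Fin q × Fin q) ℂ)} (hμ : ∀ t, IsTwoDesign (μ t))
    {M : OperatorBasis q} {c : (Fin n → Fin (q ^ 2)) → ℂ} (hc : c ≠ 0)
    (hH : (M.observable c).IsHermitian) {ε δ : ℝ} (hε : 0 < ε) (hδ : 0 < δ) (hδ' : δ < 1) :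
    (U.estimator c hc (numSamples (weight c) ε δ)).toOuterMeasure
      {y | ε < |y - U.secondMoment μ (M.observable c)|} ≤ ENNReal.ofReal δ := by
  rw [U.estimator_eq, U.sample_eq, ← weight_mul_hit U hq hμ hc hH]
  exact toOuterMeasure_empirical_mean_le (U.hit c hc) (weight_pos hc) hε hδ hδ'

end Estimator

/-! ### Couplings of probability laws. -/

section Coupling

variable {α β γ δ : Type*}

/-- There is a coupling of `P` and `Q` supported in the relation `R`. -/
def Couples (P : PMF α) (Q : PMF β) (R : α → β → Prop) : Prop :=
  ∃ J : PMF (α × β), J.map Prod.fst = P ∧ J.map Prod.snd = Q ∧ ∀ z ∈ J.support, R z.1 z.2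

lemma bind_congr_support {P : PMF α} {f g : α → PMF β} (h : ∀ a ∈ P.support, f a = g a) :
    P.bind f = P.bind g := by
  ext b
  simp only [PMF.bind_apply]
  refine tsum_congr fun a => ?_
  by_cases ha : a ∈ P.support
  · rw [h a ha]
  · rw [(PMF.apply_eq_zero_iff P a).mpr ha, zero_mul, zero_mul]

lemma Couples.of_map (P : PMF α) {f : α → β} {g : α → γ} {R : β → γ → Prop}
    (h : ∀ a, R (f a) (g a)) : Couples (P.map f) (P.map g) R := by
  refine ⟨P.map fun a => (f a, g a), ?_, ?_, ?_⟩
  · rw [PMF.map_comp]; rfl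
  · rw [PMF.map_comp]; rfl
  · intro z hz
    obtain ⟨a, -, rfl⟩ := (PMF.mem_support_map_iff _ _ _).mp hz
    exact h a

lemma Couples.pure {a : α} {b : β} {R : α → β → Prop} (h : R a b) :
    Couples (PMF.pure a) (PMF.pure b) R := by
  refine ⟨PMF.pure (a, b), PMF.pure_map _ _, PMF.pure_map _ _, ?_⟩
  intro z hz
  rw [PMF.support_pure, Set.mem_singleton_iff] at hz
  subst hz
  exact h

lemma Couples.mono {P : PMF α} {Q : PMF β} {R R' : α → β → Prop} (h : Couples P Q R)
    (hR : ∀ a b, R a b → R' a b) : Couples P Q R' := by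
  obtain ⟨J, h1, h2, h3⟩ := h
  exact ⟨J, h1, h2, fun z hz => hR _ _ (h3 z hz)⟩

/-- Couplings are glued by choosing one of `f a` and `g b` for each related pair. -/
lemma Couples.bind {P : PMF α} {Q : PMF β} {R : α → β → Prop} (h : Couples P Q R)
    {f : α → PMF γ} {g : β → PMF δ} {R' : γ → δ → Prop}
    (hfg : ∀ a b, R a b → Couples (f a) (g b) R') : Couples (P.bind f) (Q.bind g) R' := by
  classical
  obtain ⟨J, rfl, rfl, h3⟩ := h
  let K : α × β → PMF (γ × δ) := fun z =>
    if hz : R z.1 z.2 then (hfg z.1 z.2 hz).choose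
    -- A filler on unrelated pairs, which have probability zero under J.
    else (f z.1).bind fun c => (g z.2).map fun d => (c, d)
  have hK : ∀ z ∈ J.support, (K z).map Prod.fst = f z.1 ∧ (K z).map Prod.snd = g z.2 ∧
      ∀ w ∈ (K z).support, R' w.1 w.2 := fun z hz => by
    have : K z = (hfg z.1 z.2 (h3 z hz)).choose := dif_pos (h3 z hz)
    rw [this]
    exact (hfg z.1 z.2 (h3 z hz)).choose_spec
  refine ⟨J.bind K, ?_, ?_, ?_⟩
  · rw [PMF.map_bind, PMF.bind_map]
    exact bind_congr_support fun z hz => (hK z hz).1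
  · rw [PMF.map_bind, PMF.bind_map]
    exact bind_congr_support fun z hz => (hK z hz).2.1
  · intro w hw
    obtain ⟨z, hz, hw⟩ := (PMF.mem_support_bind_iff _ _ _).mp hw
    exact (hK z hz).2.2 w hw

lemma Couples.map_left {P : PMF α} {Q : PMF β} {R : α → β → Prop} (h : Couples P Q R)
    {f : α → γ} {R' : γ → β → Prop} (hf : ∀ a b, R a b → R' (f a) b) :
    Couples (P.map f) Q R' := by
  rw [← PMF.bind_pure Q]
  exact h.bind fun a b hab => Couples.pure (hf a b hab)

/-- Turns a simulation into an exact equality of output laws. -/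
lemma Couples.map_eq {P : PMF α} {Q : PMF β} {R : α → β → Prop} (h : Couples P Q R)
    {f : α → γ} {g : β → γ} (hfg : ∀ a b, R a b → f a = g b) : P.map f = Q.map g := by
  obtain ⟨J, rfl, rfl, h3⟩ := h
  rw [PMF.map_comp, PMF.map_comp]
  exact bind_congr_support fun z hz => congrArg PMF.pure (hfg _ _ (h3 z hz))

/-- Turns a relation inside a coupling into a statement about every possible run; this makes the
time bound certain. -/
lemma Couples.exists_of_mem_support {P : PMF α} {Q : PMF β} {R : α → β → Prop}
    (h : Couples P Q R) {a : α} (ha : a ∈ P.support) : ∃ b, R a b := by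
  obtain ⟨J, rfl, rfl, h3⟩ := h
  obtain ⟨z, hz, rfl⟩ := (PMF.mem_support_map_iff _ _ _).mp ha
  exact ⟨z.2, h3 z hz⟩

end Coupling

/-! ### A relational program logic with time bounds. -/

section ProgramLogic

variable {L : ℕ} {D : PMF (Fin L → ℕ)} {β γ : Type}

/-- The command `c`, started in `σ`, takes at most `T` units of time, and its final memory can be
coupled to the law `Q` so that `R` holds. -/
def Sim (D : PMF (Fin L → ℕ)) (c : Cmd) (σ : Store) (Q : PMF β) (R : Store → β → Prop)
    (T : ℕ) : Prop :=
  Couples (c.run D σ) Q fun o b => R o.1 b ∧ o.2 ≤ T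

namespace Sim

variable {c c₁ c₂ : Cmd} {σ : Store} {Q : PMF β} {R R' : Store → β → Prop} {T T' T₁ T₂ : ℕ}

lemma mono (h : Sim D c σ Q R T) (hR : ∀ σ' b, R σ' b → R' σ' b) (hT : T ≤ T') :
    Sim D c σ Q R' T' :=
  Couples.mono h fun _ _ ho => ⟨hR _ _ ho.1, ho.2.trans hT⟩

lemma mono_time (h : Sim D c σ Q R T) (hT : T ≤ T') : Sim D c σ Q R T' :=
  h.mono (fun _ _ => id) hT

lemma skip {b : β} (h : R σ b) : Sim D .skip σ (PMF.pure b) R 1 :=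
  Couples.pure ⟨h, le_rfl⟩

lemma seq (h₁ : Sim D c₁ σ Q R T₁) {g : β → PMF γ} {R' : Store → γ → Prop}
    (h₂ : ∀ σ' b, R σ' b → Sim D c₂ σ' (g b) R' T₂) :
    Sim D (.seq c₁ c₂) σ (Q.bind g) R' (T₁ + T₂ + 1) :=
  Couples.bind h₁ fun o b hob => (h₂ o.1 b hob.1).map_left fun o' b' ho' =>
    ⟨ho'.1, by have := ho'.2; have := hob.2; dsimp only; omega⟩

/-- Sequencing after a command without random outcome. -/
lemma det_seq {R₁ : Store → Prop} (h₁ : Sim D c₁ σ (PMF.pure ()) (fun σ' _ => R₁ σ') T₁)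
    (h₂ : ∀ σ', R₁ σ' → Sim D c₂ σ' Q R T₂) : Sim D (.seq c₁ c₂) σ Q R (T₁ + T₂ + 1) := by
  have := h₁.seq (g := fun _ => Q) (R' := R) (T₂ := T₂) fun σ' _ h => h₂ σ' h
  rwa [PMF.pure_bind] at this

lemma setN_seq {r : NReg} {e : NExpr} (h : Sim D c (σ.setN r (e.eval σ)) Q R T) :
    Sim D (.seq (.setN r e) c) σ Q R (e.cost + 1 + T + 1) :=
  det_seq (R₁ := fun σ' => σ' = σ.setN r (e.eval σ)) (Couples.pure ⟨rfl, le_rfl⟩)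
    fun _ hσ => hσ ▸ h

lemma setR_seq {r : RReg} {e : RExpr} (h : Sim D c (σ.setR r (e.eval σ)) Q R T) :
    Sim D (.seq (.setR r e) c) σ Q R (e.cost + 1 + T + 1) :=
  det_seq (R₁ := fun σ' => σ' = σ.setR r (e.eval σ)) (Couples.pure ⟨rfl, le_rfl⟩)
    fun _ hσ => hσ ▸ h

lemma ceil_seq {r : NReg} {e : RExpr} (h : Sim D c (σ.setN r ⌈e.eval σ⌉₊) Q R T) :
    Sim D (.seq (.ceil r e) c) σ Q R (e.cost + 1 + T + 1) :=
  det_seq (R₁ := fun σ' => σ' = σ.setN r ⌈e.eval σ⌉₊) (Couples.pure ⟨rfl, le_rfl⟩)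
    fun _ hσ => hσ ▸ h

lemma setCell_seq {a : Arr} {e₁ e₂ : NExpr}
    (h : Sim D c (σ.setArr a (Function.update (σ.arr a) (e₁.eval σ) (e₂.eval σ))) Q R T) :
    Sim D (.seq (.setCell a e₁ e₂) c) σ Q R (e₁.cost + e₂.cost + 1 + T + 1) :=
  det_seq (R₁ := fun σ' => σ' = σ.setArr a (Function.update (σ.arr a) (e₁.eval σ) (e₂.eval σ)))
    (Couples.pure ⟨rfl, le_rfl⟩) fun _ hσ => hσ ▸ h

lemma setN_det {r : NReg} {e : NExpr} {b : β} (h : R (σ.setN r (e.eval σ)) b) :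
    Sim D (.setN r e) σ (PMF.pure b) R (e.cost + 1) :=
  Couples.pure ⟨h, le_rfl⟩

lemma flip_seq {r : NReg} {e : RExpr} {g : Bool → β}
    (h : ∀ b, Sim D c (σ.setN r (if b then 1 else 0)) (PMF.pure (g b)) R T) :
    Sim D (.seq (.flip r e) c) σ ((coin (e.eval σ)).map g) R (e.cost + 1 + T + 1) :=
  seq (Q := coin (e.eval σ)) (R := fun σ' b => σ' = σ.setN r (if b then 1 else 0))
    (by
      have := Couples.of_map (coin (e.eval σ))
        (f := fun b => (σ.setN r (if b then 1 else 0), e.cost + 1))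
        (g := id) (R := fun o b => o.1 = σ.setN r (if b then 1 else 0) ∧ o.2 ≤ e.cost + 1)
        fun b => ⟨rfl, le_rfl⟩
      rwa [PMF.map_id] at this)
    fun _ b hσ => hσ ▸ h b

/-- The oracle law is a pushforward; coupling with the underlying sample x keeps x available for the
rest of the derivation. -/
lemma draw_seq {X : Type} {P : PMF X} {f : X → Fin L → ℕ} {a : Arr} {g : X → PMF β}
    (h : ∀ x, Sim (P.map f) c (σ.setArr a fun k => if h : k < L then f x ⟨k, h⟩ else σ.arr a k)
      (g x) R T) :
    Sim (P.map f) (.seq (.draw a) c) σ (P.bind g) R (L + 1 + T + 1) :=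
  seq (R := fun σ' x => σ' = σ.setArr a fun k => if h : k < L then f x ⟨k, h⟩ else σ.arr a k)
    (by
      have := Couples.of_map P
        (f := (fun x => (σ.setArr a (fun k => if h : k < L then x ⟨k, h⟩ else σ.arr a k), L + 1)) ∘
          f)
        (g := id) (R := fun o x => o.1 = σ.setArr a (fun k => if h : k < L then f x ⟨k, h⟩
          else σ.arr a k) ∧ o.2 ≤ L + 1)
        fun b => ⟨rfl, le_rfl⟩
      rw [PMF.map_id, ← PMF.map_comp] at this
      exact this)
    fun _ x hσ => hσ ▸ h x

/-- Serves the last command of a `Cmd.block`, which is followed by `skip`: one unit for it and one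
for the `seq`. -/
lemma seq_skip (h : Sim D c σ Q R T) : Sim D (.seq c .skip) σ Q R (T + 2) := by
  have := h.seq (R' := R) fun _ _ hR => skip (D := D) hR
  rwa [PMF.bind_pure] at this

lemma ifEq {e₁ e₂ : NExpr} (h₁ : e₁.eval σ = e₂.eval σ → Sim D c₁ σ Q R T)
    (h₂ : e₁.eval σ ≠ e₂.eval σ → Sim D c₂ σ Q R T) :
    Sim D (.ifEq e₁ e₂ c₁ c₂) σ Q R (T + e₁.cost + e₂.cost + 1) := by
  have h : Couples (if e₁.eval σ = e₂.eval σ then c₁.run D σ else c₂.run D σ) Q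
      (fun o b => R o.1 b ∧ o.2 ≤ T) := by
    split_ifs with h
    · exact h₁ h
    · exact h₂ h
  exact h.map_left fun o b ho => ⟨ho.1, by have := ho.2; dsimp only; omega⟩

end Sim

/-- Iterates a kernel that may depend on time. -/
def iterBind (g : ℕ → β → PMF β) (b : β) : ℕ → PMF β
  | 0 => PMF.pure b
  | k + 1 => (iterBind g b k).bind (g k)

lemma iterBind_pure {b : β} (k : ℕ) : iterBind (fun _ => PMF.pure) b k = PMF.pure b := by
  induction k with
  | zero => rfl
  | succ k ih => rw [iterBind, ih, PMF.pure_bind]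

lemma foldl_finRange_eq_iterBind {m : ℕ} (G : Fin m → β → PMF β) (g : ℕ → β → PMF β)
    (h : ∀ t : Fin m, G t = g t) (b : β) :
    (List.finRange m).foldl (fun P t => P.bind (G t)) (PMF.pure b) = iterBind g b m := by
  induction m with
  | zero => rfl
  | succ m ih =>
    rw [List.finRange_succ_last, List.foldl_append, List.foldl_map]
    simp only [List.foldl_cons, List.foldl_nil]
    rw [ih (fun t => G t.castSucc) fun t => h t.castSucc, h]
    rfl

lemma foldl_bind_eq_bind {κ : Type} (G : κ → β → PMF β) (l : List κ) (P : PMF β) :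
    l.foldl (fun P t => P.bind (G t)) P =
      P.bind fun b => l.foldl (fun P t => P.bind (G t)) (PMF.pure b) := by
  induction l using List.reverseRecOn with
  | nil => simp
  | append_singleton l t ih =>
    simp only [List.foldl_append, List.foldl_cons, List.foldl_nil]
    rw [ih, PMF.bind_bind]

/-- Invariant rule: `I k` relates the memory after k iterations to the ideal chain after k steps.
Each iteration pays one extra unit for the counter, while the bound e is evaluated only once. -/
lemma Sim.loop {c : Cmd} {r : NReg} {e : NExpr} {σ : Store} {T K : ℕ} (hK : e.eval σ = K)
    {g : ℕ → β → PMF β} {b₀ : β} (I : ℕ → Store → β → Prop) (h₀ : I 0 σ b₀)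
    (hstep : ∀ k < K, ∀ σ' b, I k σ' b → Sim D c (σ'.setN r k) (g k b) (I (k + 1)) T) :
    Sim D (.loop r e c) σ (iterBind g b₀ K) (I K) (K * (T + 1) + e.cost + 1) := by
  have key : ∀ k ≤ K, Couples (runLoop (c.run D) r σ k) (iterBind g b₀ k)
      (fun o b => I k o.1 b ∧ o.2 ≤ k * (T + 1)) := by
    intro k
    induction k with
    | zero => exact fun _ => Couples.pure ⟨h₀, by simp⟩
    | succ k ih =>
      intro hk
      refine (ih (by omega)).bind fun o b hob =>
        (hstep k (by omega) o.1 b hob.1).map_left fun o' b' ho' => ⟨ho'.1, ?_⟩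
      have h1 := ho'.2
      have h2 := hob.2
      rw [Nat.succ_mul]
      dsimp only
      omega
  subst hK
  exact (key _ le_rfl).map_left fun o b ho => ⟨ho.1, by have := ho.2; dsimp only; omega⟩

lemma Sim.loop_det {c : Cmd} {r : NReg} {e : NExpr} {σ : Store} {T K : ℕ} (hK : e.eval σ = K)
    (I : ℕ → Store → Prop) (h₀ : I 0 σ)
    (hstep : ∀ k < K, ∀ σ', I k σ' →
      Sim D c (σ'.setN r k) (PMF.pure ()) (fun σ'' _ => I (k + 1) σ'') T) :
    Sim D (.loop r e c) σ (PMF.pure ()) (fun σ' _ => I K σ') (K * (T + 1) + e.cost + 1) := by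
  have := Sim.loop (D := D) hK (g := fun _ => PMF.pure) (b₀ := ()) (fun k σ' _ => I k σ') h₀
    fun k hk σ' _ hI => hstep k hk σ' hI
  rwa [iterBind_pure] at this

end ProgramLogic

/-! ### Verification of the Monte Carlo program. -/

section MonteCarlo

variable {n q m p L : ℕ} {D : PMF (Fin L → ℕ)}

/-- The part of the memory that one round of the algorithm does not change. -/
structure Frame (U : Circuit n q m p) (S : ℝ) (N count : ℕ) (σ : Store) : Prop where
  nat_n : σ.nat .n = n
  nat_m : σ.nat .m = m
  nat_N : σ.nat .N = N
  nat_count : σ.nat .count = count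
  real_S : σ.real .S = S
  p0 : σ.real .p0 = 1 / ((q : ℝ) + 1)
  p1 : σ.real .p1 = 1 / ((q : ℝ) ^ 2 + 1)
  fst : ∀ t : Fin m, σ.arr .gateFst t = (U.block t).fst
  snd : ∀ t : Fin m, σ.arr .gateSnd t = (U.block t).snd

variable {U : Circuit n q m p} {S : ℝ} {N count : ℕ} {σ : Store}

lemma Frame.setN (h : Frame U S N count σ) {r : NReg}
    (hr : r ≠ .n ∧ r ≠ .m ∧ r ≠ .N ∧ r ≠ .count) (k : ℕ) : Frame U S N count (σ.setN r k) := by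
  obtain ⟨h1, h2, h3, h4⟩ := hr
  constructor <;> simp [Store.setN, h1.symm, h2.symm, h3.symm, h4.symm, h.nat_n, h.nat_m, h.nat_N,
    h.nat_count, h.real_S, h.p0, h.p1, h.fst, h.snd]

lemma Frame.setArr (h : Frame U S N count σ) {a : Arr} (ha : a ≠ .gateFst ∧ a ≠ .gateSnd)
    (f : ℕ → ℕ) : Frame U S N count (σ.setArr a f) := by
  obtain ⟨h1, h2⟩ := ha
  constructor <;> simp [Store.setArr, h1.symm, h2.symm, h.nat_n, h.nat_m, h.nat_N,
    h.nat_count, h.real_S, h.p0, h.p1, h.fst, h.snd]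

/-- The array `label` holds the configuration `γ` on the first `k` sites. -/
def HasLabels (k : ℕ) (σ : Store) (γ : Config n) : Prop :=
  ∀ j : Fin n, (j : ℕ) < k → σ.arr .label j = if γ j then 1 else 0

/-- The kernel that labels one site of the initial configuration. -/
def labelSite (q : ℕ) (k : Fin n) (γ : Config n) : PMF (Config n) :=
  (coin (1 / ((q : ℝ) + 1))).map fun b => Function.update γ k b

/-- The program labels sites one at a time, whereas `initConfig` is a product law. The explicit mass
function at intermediate times makes the comparison an induction; sites not yet reached hold the
placeholder `false`. -/
lemma iterBind_labelSite_apply (k : ℕ) (hk : k ≤ n) (γ : Config n) :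
    iterBind (fun k γ => if h : k < n then labelSite q ⟨k, h⟩ γ else PMF.pure γ)
      (fun _ => false) k γ =
      ∏ j : Fin n, if (j : ℕ) < k then coin (1 / ((q : ℝ) + 1)) (γ j)
        else if γ j = false then 1 else 0 := by
  induction k generalizing γ with
  | zero =>
    simp only [iterBind, PMF.pure_apply, Nat.not_lt_zero, if_false]
    rw [Finset.prod_ite_zero]
    simp [funext_iff]
  | succ k ih =>
    have hkn : k < n := hk
    set i : Fin n := ⟨k, hkn⟩ with hi
    rw [iterBind, PMF.bind_apply]
    simp only [hkn, dif_pos, ← hi]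
    have h1 : ∀ γ' : Config n, labelSite q i γ' γ =
        if γ = Function.update γ' i (γ i) then coin (1 / ((q : ℝ) + 1)) (γ i) else 0 := by
      intro γ'
      rw [labelSite, PMF.map_apply]
      rw [tsum_eq_single (γ i)]
      · congr
      intro b hb
      rw [if_neg]
      intro h
      apply hb
      simpa using (congrFun h i).symm
    simp only [h1]
    rw [tsum_eq_single (Function.update γ i false)]
    · rw [ih (by omega), Function.update_idem, Function.update_eq_self, if_pos rfl,
        ← Finset.mul_prod_erase _ _ (Finset.mem_univ i),
        ← Finset.mul_prod_erase (Finset.univ : Finset (Fin n)) _ (Finset.mem_univ i)]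
      simp only [hi, lt_irrefl, if_false, Function.update_self, if_true, one_mul,
        Nat.lt_succ_self, mul_comm]
      congr 1
      refine Finset.prod_congr rfl fun j hj => ?_
      have hji : j ≠ i := Finset.ne_of_mem_erase hj
      have hjk : (j : ℕ) ≠ k := fun h => hji (Fin.ext h)
      have : (j : ℕ) < k + 1 ↔ (j : ℕ) < k := by omega
      rw [Function.update_of_ne (by exact hji)]
      simp [this]
    · intro γ' hγ'
      by_cases h : γ = Function.update γ' i (γ i)
      · rw [if_pos h, ih (by omega)]
        have hne : γ' i ≠ false := by
          intro hf
          apply hγ'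
          rw [h, Function.update_idem]
          rw [← hf, Function.update_eq_self]
        rw [Finset.prod_eq_zero (Finset.mem_univ i) (by simp [hi] at hne ⊢; simp [hne]), zero_mul]
      · rw [if_neg h, mul_zero]

lemma iterBind_labelSite : iterBind
    (fun k γ => if h : k < n then labelSite q ⟨k, h⟩ γ else PMF.pure γ) (fun _ => false) n =
      initConfig n q := by
  ext γ
  rw [iterBind_labelSite_apply n le_rfl]
  simp [initConfig_apply]

/-- Separates the two loops of the program. The kernel is indexed by natural numbers to match the
loop counter, and its value past m is never used. -/
lemma finalConfig_eq (U : Circuit n q m p) : U.finalConfig = (initConfig n q).bind fun γ =>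
    iterBind (fun t γ => if h : t < m then gateStep q (U.block ⟨t, h⟩).fst (U.block ⟨t, h⟩).snd γ
      else PMF.pure γ) γ m := by
  unfold Circuit.finalConfig
  rw [foldl_bind_eq_bind fun t => gateStep q (U.block t).fst (U.block t).snd]
  congr 1
  ext1 γ
  exact foldl_finRange_eq_iterBind _ _ (fun t => by ext1; simp) γ

lemma sim_labelSite {k : ℕ} (hk : k < n) (hF : Frame U S N count σ) {γ : Config n}
    (hγ : HasLabels k σ γ) :
    Sim D (.block [.flip .b (.reg .p0), .setCell .label (.reg .s) (.reg .b)]) (σ.setN .s k)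
      (labelSite q ⟨k, hk⟩ γ)
      (fun σ' γ' => Frame U S N count σ' ∧ HasLabels (k + 1) σ' γ') 8 := by
  have hF' := hF.setN (r := .s) (by decide) k
  have hp : 1 / ((q : ℝ) + 1) = (RExpr.reg .p0).eval (σ.setN .s k) := hF'.p0.symm
  rw [labelSite, hp]
  apply Sim.mono_time
  · refine Sim.flip_seq fun b => Sim.setCell_seq (Sim.skip ⟨(hF'.setN (by decide) _).setArr
      (by decide) _, ?_⟩)
    intro j hj
    by_cases hjk : (j : ℕ) = k
    · have : j = ⟨k, hk⟩ := Fin.ext hjk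
      subst this
      simp [Store.setN, Store.setArr, NExpr.eval]
    · have hj' : j ≠ ⟨k, hk⟩ := fun h => hjk (congrArg Fin.val h)
      have := hγ j (by omega)
      simp [Store.setN, Store.setArr, NExpr.eval, hjk, Function.update_of_ne hj', this]
  · simp [NExpr.cost, RExpr.cost]

lemma sim_gateStep (t : Fin m) (hF : Frame U S N count σ) {γ : Config n} (hγ : HasLabels n σ γ) :
    Sim D (.block [
        .setN .u (.cell .gateFst (.reg .t)),
        .setN .v (.cell .gateSnd (.reg .t)),
        .ifEq (.cell .label (.reg .u)) (.cell .label (.reg .v)) .skip (.block [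
          .flip .b (.reg .p1),
          .setCell .label (.reg .u) (.reg .b),
          .setCell .label (.reg .v) (.reg .b)])]) (σ.setN .t t)
      (gateStep q (U.block t).fst (U.block t).snd γ)
      (fun σ' γ' => Frame U S N count σ' ∧ HasLabels n σ' γ') 27 := by
  have hF₁ := hF.setN (r := .t) (by decide) t
  have hu : (NExpr.cell .gateFst (.reg .t)).eval (σ.setN .t t) = (U.block t).fst := by
    simpa [NExpr.eval, Store.setN] using hF.fst t
  have hv : (NExpr.cell .gateSnd (.reg .t)).eval
      ((σ.setN .t t).setN .u (U.block t).fst) = (U.block t).snd := by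
    simpa [NExpr.eval, Store.setN] using hF.snd t
  set σ' := ((σ.setN .t t).setN .u (U.block t).fst).setN .v (U.block t).snd with hσ'
  have hF' : Frame U S N count σ' := (hF₁.setN (by decide) _).setN (by decide) _
  have hγ' : HasLabels n σ' γ := hγ
  have hl₁ : (NExpr.cell .label (.reg .u)).eval σ' = if γ (U.block t).fst then 1 else 0 := by
    simpa [NExpr.eval, hσ', Store.setN] using hγ _ (U.block t).fst.2
  have hl₂ : (NExpr.cell .label (.reg .v)).eval σ' = if γ (U.block t).snd then 1 else 0 := by
    simpa [NExpr.eval, hσ', Store.setN] using hγ _ (U.block t).snd.2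
  -- The cells hold only 0 and 1, so the machine's comparison decides equality of labels.
  have hiff : (NExpr.cell .label (.reg .u)).eval σ' = (NExpr.cell .label (.reg .v)).eval σ' ↔
      γ (U.block t).fst = γ (U.block t).snd := by
    rw [hl₁, hl₂]
    cases γ (U.block t).fst <;> cases γ (U.block t).snd <;> simp
  apply Sim.mono_time
  · refine Sim.setN_seq (T := 23) ?_
    rw [hu]
    refine Sim.setN_seq (T := 19) ?_
    rw [hv]
    refine Sim.seq_skip (T := 17) ?_
    refine Sim.mono_time (Sim.ifEq (T := 12) ?_ ?_) (by simp [NExpr.cost])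
    · intro h
      rw [gateStep, if_pos (hiff.mp h)]
      exact (Sim.skip ⟨hF', hγ'⟩).mono_time (by norm_num)
    · intro h
      rw [gateStep, if_neg fun h' => h (hiff.mpr h')]
      have hp : 1 / ((q : ℝ) ^ 2 + 1) = (RExpr.reg .p1).eval σ' := hF'.p1.symm
      rw [hp]
      apply Sim.mono_time
      · refine Sim.flip_seq fun b => Sim.setCell_seq (Sim.setCell_seq (Sim.skip
          ⟨((hF'.setN (by decide) _).setArr (by decide) _).setArr (by decide) _, ?_⟩))
        intro j hj
        -- The second site is written last, which matches the outer `Function.update` in `gateStep`.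
        by_cases hj2 : j = (U.block t).snd
        · subst hj2
          simp [Store.setN, Store.setArr, NExpr.eval]
        · have hj2' : (j : ℕ) ≠ (U.block t).snd := fun h => hj2 (Fin.ext h)
          by_cases hj1 : j = (U.block t).fst
          · subst hj1
            simp [Store.setN, Store.setArr, NExpr.eval, hj2', hj2]
          · have hj1' : (j : ℕ) ≠ (U.block t).fst := fun h => hj1 (Fin.ext h)
            have := hγ j hj
            simp [Store.setN, Store.setArr, NExpr.eval, hj2', hj2, hj1, hj1', this]
      · simp [NExpr.cost, RExpr.cost]
  · simp [NExpr.cost]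

lemma sim_simulateWalk (hF : Frame U S N count σ) :
    Sim D simulateWalk σ U.finalConfig
      (fun σ' γ => Frame U S N count σ' ∧ HasLabels n σ' γ) (n * 9 + m * 28 + 8) := by
  rw [finalConfig_eq, ← iterBind_labelSite]
  apply Sim.mono_time
  · refine Sim.seq (T₂ := m * 28 + 4) (R := fun σ' γ => Frame U S N count σ' ∧ HasLabels n σ' γ)
      (Sim.loop (K := n) (T := 8) (e := .reg .n) hF.nat_n
        (fun k σ' γ => Frame U S N count σ' ∧ HasLabels k σ' γ)
        -- Nothing is required of the labels at the start: those left by the previous round are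
        -- overwritten before being read.
        ⟨hF, fun j hj => absurd hj (Nat.not_lt_zero _)⟩ ?_) ?_
    · rintro k hk σ' γ ⟨hF', hγ⟩
      simp only [hk, dif_pos]
      exact sim_labelSite hk hF' hγ
    · rintro σ' γ ⟨hF', hγ⟩
      refine Sim.seq_skip (Sim.loop (K := m) (T := 27) (e := .reg .m) hF'.nat_m
        (fun _ σ' γ => Frame U S N count σ' ∧ HasLabels n σ' γ) ⟨hF', hγ⟩ ?_)
      rintro k hk σ' γ ⟨hF', hγ⟩
      simp only [hk, dif_pos]
      exact sim_gateStep ⟨k, hk⟩ hF' hγ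
  · simp [NExpr.cost]
    omega

lemma sim_testSupport (hF : Frame U S N count σ) {γ : Config n} (hγ : HasLabels n σ γ)
    {x : Fin n → Fin (q ^ 2)} [NeZero q] (hx : ∀ j : Fin n, σ.arr .X j = x j) :
    Sim D testSupport σ (PMF.pure ())
      (fun σ' _ => Frame U S N count σ' ∧
        σ'.nat .hit = if ∀ k, x k ≠ 0 → γ k = true then 1 else 0) (n * 11 + 7) := by
  -- After k iterations `hit` decides the inclusion on the first k sites. Its initial value 1 is the
  -- empty condition, and it is only ever lowered.
  set I : ℕ → Store → Prop := fun k σ' => Frame U S N count σ' ∧ HasLabels n σ' γ ∧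
    (∀ j : Fin n, σ'.arr .X j = x j) ∧
    σ'.nat .hit = if ∀ j : Fin n, (j : ℕ) < k → x j ≠ 0 → γ j = true then 1 else 0 with hI
  apply Sim.mono_time
  · refine Sim.setN_seq (T := n * 11 + 4) ?_
    refine Sim.seq_skip (T := n * 11 + 2) ?_
    refine Sim.mono (Sim.loop_det (K := n) (T := 10) (e := .reg .n)
      (hF.setN (by decide) _).nat_n I ⟨hF.setN (by decide) _, hγ, hx, ?_⟩ ?_) ?_ le_rfl
    · simp [Store.setN, NExpr.eval]
    · rintro k hk σ' ⟨hF', hγ', hx', hhit⟩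
      have hF'' := hF'.setN (r := .s) (by decide) k
      have hX : (NExpr.cell .X (.reg .s)).eval (σ'.setN .s k) = x ⟨k, hk⟩ := by
        simpa [NExpr.eval, Store.setN] using hx' ⟨k, hk⟩
      have hl : (NExpr.cell .label (.reg .s)).eval (σ'.setN .s k) =
          if γ ⟨k, hk⟩ then 1 else 0 := by
        simpa [NExpr.eval, Store.setN] using hγ' ⟨k, hk⟩ hk
      have hsucc : (∀ j : Fin n, (j : ℕ) < k + 1 → x j ≠ 0 → γ j = true) ↔
          (∀ j : Fin n, (j : ℕ) < k → x j ≠ 0 → γ j = true) ∧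
            (x ⟨k, hk⟩ ≠ 0 → γ ⟨k, hk⟩ = true) := by
        constructor
        · exact fun h => ⟨fun j hj => h j (by omega), h ⟨k, hk⟩ (Nat.lt_succ_self k)⟩
        · rintro ⟨h1, h2⟩ j hj
          rcases Nat.lt_succ_iff_lt_or_eq.mp hj with h | h
          · exact h1 j h
          · obtain rfl : j = ⟨k, hk⟩ := Fin.ext h
            exact h2
      have hkeep : (x ⟨k, hk⟩ ≠ 0 → γ ⟨k, hk⟩ = true) → I (k + 1) (σ'.setN .s k) := by
        intro h
        refine ⟨hF'', hγ', hx', ?_⟩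
        simp only [hsucc, and_iff_left h]
        exact hhit
      refine Sim.ifEq (T := 6) (fun h => (Sim.skip (hkeep ?_)).mono_time (by norm_num))
        (fun h => Sim.ifEq (T := 2) (fun h' => (Sim.skip (hkeep ?_)).mono_time (by norm_num))
          (fun h' => Sim.setN_det ⟨hF''.setN (by decide) _, hγ', hx', ?_⟩))
      · rw [hX] at h
        intro hne
        exact absurd (Fin.ext h) hne
      · rw [hl] at h'
        intro _
        by_contra hne
        simp [hne, NExpr.eval] at h'
      · have h1 : x ⟨k, hk⟩ ≠ 0 := by
          intro h0
          rw [hX, h0] at h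
          exact h rfl
        have h2 : γ ⟨k, hk⟩ ≠ true := by
          intro h0
          rw [hl, h0] at h'
          exact h' rfl
        rw [if_neg fun hall => h2 ((hsucc.mp hall).2 h1)]
        simp [Store.setN, NExpr.eval]
    · rintro σ' _ ⟨hF', -, -, hhit⟩
      refine ⟨hF', hhit.trans ?_⟩
      simp only [Fin.is_lt, true_imp_iff]
  · simp [NExpr.cost]
    omega

lemma sim_round [NeZero q] (c : (Fin n → Fin (q ^ 2)) → ℂ) (hc : c ≠ 0)
    (hF : Frame U S N count σ) :
    Sim ((coeffPMF c hc).map fun x k => (x k : ℕ)) (.block [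
        simulateWalk,
        .draw .X,
        testSupport,
        .setN .count (.add (.reg .count) (.reg .hit))]) σ
      ((U.sample c hc).map fun a => count + a)
      (fun σ' s => Frame U S N s σ') (n * 21 + m * 28 + 25) := by
  have hQ : (U.sample c hc).map (fun a => count + a) = U.finalConfig.bind fun γ =>
      (coeffPMF c hc).bind fun x =>
        PMF.pure (count + if ∀ k, x k ≠ 0 → γ k = true then 1 else 0) := by
    simp only [Circuit.sample, PMF.map_bind, PMF.map_comp]
    rfl
  rw [hQ]
  apply Sim.mono_time
  · refine Sim.seq (T₂ := n * 12 + 16) (sim_simulateWalk hF) ?_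
    rintro σ₁ γ ⟨hF₁, hγ⟩
    refine Sim.mono_time (T := n + 1 + (n * 11 + 14) + 1) (Sim.draw_seq fun x => ?_) (by omega)
    refine Sim.mono_time (T := n * 11 + 7 + 6 + 1) ?_ (by omega)
    refine Sim.det_seq (T₂ := 6) (sim_testSupport (γ := γ) (x := x) (hF₁.setArr (by decide) _)
      ?_ ?_) ?_
    · exact hγ
    · intro j
      simp [Store.setArr]
    · rintro σ₂ ⟨hF₂, hhit⟩
      refine Sim.seq_skip (T := 4) (Sim.setN_det ?_)
      have hval : (NExpr.add (.reg .count) (.reg .hit)).eval σ₂ =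
          count + if ∀ k, x k ≠ 0 → γ k = true then 1 else 0 := by
        simp only [NExpr.eval, hF₂.nat_count, hhit]
      rw [hval]
      constructor <;> simp [Store.setN, hF₂.nat_n, hF₂.nat_m, hF₂.nat_N, hF₂.real_S, hF₂.p0,
        hF₂.p1, hF₂.fst, hF₂.snd]
  · omega

lemma sim_setup (U : Circuit n q m p) (S ε δ : ℝ) :
    Sim D setup (U.input S ε δ) (PMF.pure ())
      (fun σ' _ => Frame U S (numSamples S ε δ) 0 σ') 50 := by
  apply Sim.mono_time
  · refine Sim.ceil_seq (Sim.setR_seq (Sim.setR_seq (Sim.setN_seq (Sim.skip ?_))))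
    constructor <;> simp [Store.setN, Store.setR, Circuit.input, NExpr.eval, RExpr.eval,
      numSamples, sq]
  · simp [NExpr.cost, RExpr.cost]

lemma iterBind_eq_sumIID (P : PMF ℕ) (N : ℕ) :
    iterBind (fun _ s => P.map fun a => s + a) 0 N = sumIID P N := by
  induction N with
  | zero => rfl
  | succ N ih => rw [iterBind, sumIID, ih]

/-- The law of the output of the program, and a bound for its running time. -/
theorem sim_monteCarlo [NeZero q] (U : Circuit n q m p) (c : (Fin n → Fin (q ^ 2)) → ℂ)
    (hc : c ≠ 0) (S ε δ : ℝ) :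
    Sim ((coeffPMF c hc).map fun x k => (x k : ℕ)) monteCarlo (U.input S ε δ)
      (sumIID (U.sample c hc) (numSamples S ε δ))
      (fun σ' s => σ'.real .out = S * ((numSamples S ε δ : ℕ) : ℝ)⁻¹ * (s : ℝ))
      (numSamples S ε δ * (n * 21 + m * 28 + 26) + 80) := by
  set N := numSamples S ε δ
  apply Sim.mono_time
  · refine Sim.det_seq (T₂ := N * (n * 21 + m * 28 + 26) + 20) (sim_setup U S ε δ) fun σ₁ hF₁ => ?_
    rw [← PMF.bind_pure (sumIID (U.sample c hc) N), ← iterBind_eq_sumIID]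
    refine Sim.mono_time (Sim.seq (T₂ := 15) (Sim.loop (K := N) (T := n * 21 + m * 28 + 25)
      (e := .reg .N) hF₁.nat_N (fun _ σ' s => Frame U S N s σ') hF₁ ?_) ?_) (T' := _) ?_
    · intro k _ σ' s hF'
      exact sim_round c hc (hF'.setN (by decide) k)
    · intro σ₂ s hF₂
      apply Sim.mono_time
      · refine Sim.setR_seq (Sim.skip ?_)
        simp [Store.setR, RExpr.eval, NExpr.eval, hF₂.real_S, hF₂.nat_N, hF₂.nat_count]
      · simp [NExpr.cost, RExpr.cost]
    · simp [NExpr.cost]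
  · omega

end MonteCarlo

/-! ### Arithmetic of the running time and assembly. -/

/-- Each gate covers two sites and every site is covered; this absorbs the O(n) part of a round into
O(m). -/
lemma Circuit.sites_le {n q m p : ℕ} (U : Circuit n q m p) : n ≤ 2 * m := by
  have h : Function.Surjective fun z : Fin m × Bool =>
      if z.2 then (U.block z.1).fst else (U.block z.1).snd := fun k => by
    obtain ⟨t, ht | ht⟩ := U.covers k
    · exact ⟨(t, true), by simp [ht]⟩
    · exact ⟨(t, false), by simp [ht]⟩
  have := Fintype.card_le_of_surjective _ h
  simpa [mul_comm] using this

/-- For δ ≤ 1/2, log(2/δ) ≤ 2 log(1/δ), which contributes 1 to the factor 3. Rounding up adds at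
most 1 ≤ 2 log(1/δ)(S/ε)², since log 2 > 1/2 and S/ε ≥ 1, which contributes 2. -/
lemma numSamples_le {S ε δ : ℝ} (hε : 0 < ε) (hδ : 0 < δ) (hεS : ε ≤ S) (hδ' : δ ≤ 1 / 2) :
    (numSamples S ε δ : ℝ) ≤ 3 * (S ^ 2 * Real.log (1 / δ) * (ε ^ 2)⁻¹) := by
  have h2 : (2 : ℝ) ≤ 1 / δ := by rw [le_div_iff₀ hδ]; linarith
  have hlog2 : Real.log 2 ≤ Real.log (1 / δ) := Real.log_le_log (by norm_num) h2
  have hhalf : 1 / 2 < Real.log 2 := by linarith [Real.log_two_gt_d9]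
  have hlog : Real.log (2 / δ) = Real.log 2 + Real.log (1 / δ) := by
    rw [← Real.log_mul (by norm_num) (by positivity)]
    congr 1
    ring
  have hratio : 1 ≤ (S / ε) ^ 2 := by
    have : 1 ≤ S / ε := by rw [le_div_iff₀ hε]; linarith
    exact one_le_pow₀ this
  have hpos : 0 ≤ (1 / 2) * Real.log (2 / δ) * (S / ε) ^ 2 := by
    have : 0 ≤ Real.log (2 / δ) := by linarith
    positivity
  have hceil : (numSamples S ε δ : ℝ) < (1 / 2) * Real.log (2 / δ) * (S / ε) ^ 2 + 1 :=
    Nat.ceil_lt_add_one hpos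
  have heq : S ^ 2 * Real.log (1 / δ) * (ε ^ 2)⁻¹ = Real.log (1 / δ) * (S / ε) ^ 2 := by
    rw [div_pow]
    ring
  rw [heq]
  have h1 : Real.log (2 / δ) * (S / ε) ^ 2 ≤ 2 * Real.log (1 / δ) * (S / ε) ^ 2 :=
    mul_le_mul_of_nonneg_right (by linarith) (by positivity)
  have h3 : 1 / 2 ≤ Real.log (1 / δ) * (S / ε) ^ 2 := by
    nlinarith
  linarith

/-- A round costs at most 42m + 28m + 26m = 96m, and the constant 80 is at most 80mN. -/
lemma time_le {n m N : ℕ} (hn : n ≤ 2 * m) (hm : 0 < m) (hN : 0 < N) :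
    N * (n * 21 + m * 28 + 26) + 80 ≤ 176 * m * N := by
  have h1 : n * 21 + m * 28 + 26 ≤ 96 * m := by omega
  have h2 : 1 ≤ m * N := Nat.mul_pos hm hN
  nlinarith [Nat.mul_le_mul_left N h1]

end

end BarrenPlateau

theorem mainTheorem9 :
    ∃ C : ℝ, 0 < C ∧
      ∀ (n q m p : ℕ) [NeZero q] (_hn : 1 ≤ n) (_hq : 2 ≤ q)
        (U : Circuit n q m p)
        (μ : Fin m → MeasureTheory.Measure (Matrix.unitaryGroup (Fin q × Fin q) ℂ))
        (_hμ : ∀ t, IsTwoDesign (μ t))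
        (M : OperatorBasis q) (c : (Fin n → Fin (q ^ 2)) → ℂ) (hc : c ≠ 0)
        (_hH : (M.observable c).IsHermitian)
        (ε δ : ℝ) (_hε : 0 < ε) (_hδ : 0 < δ) (_hδ' : δ < 1),
        -- the output is the empirical average of `N` independent samples
        (U.runMonteCarlo c hc ε δ).map (fun o => o.1.real RReg.out) =
            U.estimator c hc (numSamples (weight c) ε δ) ∧
        -- the error exceeds `ε` with probability at most `δ`
        (U.runMonteCarlo c hc ε δ).toOuterMeasure
            {o | ε < |o.1.real RReg.out - U.secondMoment μ (M.observable c)|} ≤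
          ENNReal.ofReal δ ∧
        -- the running time
        ∀ o ∈ (U.runMonteCarlo c hc ε δ).support,
          (o.2 : ℝ) ≤ C * m * numSamples (weight c) ε δ ∧
          (ε ≤ weight c → δ ≤ 1 / 2 →
            (o.2 : ℝ) ≤ C * (m * weight c ^ 2 * Real.log (1 / δ) * (ε ^ 2)⁻¹)) := by
  -- 528 = 176·3: the factor of `time_le` times that of `numSamples_le`.
  refine ⟨528, by norm_num, ?_⟩
  intro n q m p _ hn hq U μ hμ M c hc hH ε δ hε hδ hδ'
  have hS := weight_pos hc
  have hsim := sim_monteCarlo U c hc (weight c) ε δ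
  have hout : (U.runMonteCarlo c hc ε δ).map (fun o => o.1.real RReg.out) =
      U.estimator c hc (numSamples (weight c) ε δ) := by
    rw [U.estimator_eq]
    exact hsim.map_eq fun o s ho => ho.1
  refine ⟨hout, ?_, ?_⟩
  · have h := U.toOuterMeasure_estimator_le hq hμ hc hH hε hδ hδ'
    rw [← hout, PMF.toOuterMeasure_map_apply] at h
    exact h
  · intro o ho
    obtain ⟨s, -, hT⟩ := hsim.exists_of_mem_support ho
    have hN := numSamples_pos hS hε hδ hδ'
    -- Since n ≥ 1 there is a site, and a gate must cover it.
    have hm : 0 < m := by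
      obtain ⟨t, -⟩ := U.covers ⟨0, hn⟩
      exact t.pos
    have hle : (o.2 : ℝ) ≤ 176 * m * numSamples (weight c) ε δ := by
      exact_mod_cast hT.trans (time_le U.sites_le hm hN)
    constructor
    · refine hle.trans ?_
      gcongr
      norm_num
    · intro hεS hδ2
      calc (o.2 : ℝ) ≤ 176 * m * numSamples (weight c) ε δ := hle
        _ ≤ 176 * m * (3 * (weight c ^ 2 * Real.log (1 / δ) * (ε ^ 2)⁻¹)) := by
          gcongr
          exact numSamples_le hε hδ hεS hδ2
        _ = _ := by ring
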